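/- All manifolds are smooth, Hausdorff, second countable, connected and without boundary; all bundles, sections and maps are smooth. Let $M$ be an oriented four-manifold with a fixed Lorentzian metric $g$ (signature $(3,1)$), with Hodge operator $\ast_g$. Let $\Sigma=(\mathcal M,\mathcal G,\Phi)$ be a scalar structure: a finite-dimensional Riemannian manifold $(\mathcal M,\mathcal G)$ with a function $\Phi\in C^\infty(\mathcal M,\mathbb R)$. Let $\Xi=(\mathcal S,D,J,\omega)$ be an electromagnetic structure on $\mathcal M$: a finite-rank real vector bundle $\mathcal S$ with a symplectic pairing $\omega$, a flat connection $D$ compatible with $\omega$, and a taming $J$, that is, $J\in\Gamma(\mathrm{End}(\mathcal S))$ with $J^2=-1$, $\omega(J\cdot,J\cdot)=\omega$ and $Q:=\omega(J\cdot,\cdot)$ positive definite. Put $\mathcal D=(\Sigma,\Xi)$, $\Delta=(\mathcal S,D,\omega)$, $\mathcal D_0=(\Sigma,\Delta)$, and let $\Theta_\Xi=D\circ J-J\circ D\in\Omega^1(\mathcal M,\mathrm{End}(\mathcal S))$ and $\Psi_{\mathcal D}=(\sharp_{\mathcal G}\otimes\mathrm{id})(\Theta_\Xi)\in\Gamma(\mathcal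 M,T\mathcal M\otimes \mathrm{End}(\mathcal S))$. The set $\mathrm{Sol}^g_{\mathcal D}(M)$ of global scalar-electromagnetic solutions of type $\mathcal D$ consists of all pairs $(\varphi,\mathcal V)$ of a smooth map $\varphi:M\to\mathcal M$ and a two-form $\mathcal V\in\Omega^2(M,\mathcal S^\varphi)$ with values in the pulled-back bundle $\mathcal S^\varphi=\varphi^*\mathcal S$ such that 1. $\mathcal V$ is positively polarized: $(\ast_g\otimes J^\varphi)\mathcal V=\mathcal V$; 2. the scalar equations hold: $\mathrm{Tr}_g\nabla d\varphi-(\mathrm{grad}_{\mathcal G}\Phi)\circ\varphi-\tfrac12(\ast_g\mathcal V,\Psi_{\mathcal D}^\varphi\mathcal V)=0$, where $\nabla$ is induced by the Levi-Civita connections of $g$ and $\mathcal G$, and $(\cdot,\cdot)$ is the scalar product induced by $g$ and $Q^\varphi$ on $\wedge^2T^*M\otimes\mathcal S^\varphi$, extended trivially to a $(T\mathcal M)^\varphi$-valued pairing; 3. the twisted electromagnetic equations hold: $d_{D^\varphi}\mathcal V=0$, where $D^\varphi$ is the pulled-back connection. A scalar-electromagnetic duality $f\in\mathrm{Aut}(\mathcal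 D_0)$ is an automorphism $f$ of the vector bundle $\mathcal S$, covering a diffeomorphism $f_0$ of $\mathcal M$, which preserves $\omega$, is covariantly constant with respect to $D$ (that is, $D_{df_0(v)}(f\circ s\circ f_0^{-1})=f(D_vs)$ for all sections $s$ and tangent vectors $v$), and for which $f_0$ is an isometry of $(\mathcal M,\mathcal G)$ with $\Phi\circ f_0=\Phi$. It acts on pairs $(\varphi,\mathcal V)$ by $f\diamond(\varphi,\mathcal V)=(f_0\circ\varphi,\hat f^\varphi(\mathcal V))$, where $\hat f:\mathcal S\to f_0^*\mathcal S$ is the based isomorphism induced by $f$. Let $\mathcal D_f=(\Sigma,\Xi_f)$ with $\Xi_f=(\mathcal S,D,\mathbf{Ad}(f)(J),\omega)$, $\mathbf{Ad}(f)(J)=f\circ J\circ f^{-1}$; this is again an electromagnetic structure. Theorem. For every $f\in\mathrm{Aut}(\mathcal D_0)$, the map $(\varphi,\mathcal V)\mapsto f\diamond(\varphi,\mathcal V)$ restricts to a bijection from $\mathrm{Sol}^g_{\mathcal D}(M)$ onto $\mathrm{Sol}^g_{\mathcal D_f}(M)$; in particular $f\diamond\mathrm{Sol}^g_{\mathcal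 D}(M)=\mathrm{Sol}^g_{\mathcal D_f}(M)$. -/

import Mathlib

open Bundle Module Set
open scoped Manifold ContDiff Topology

noncomputable section

set_option linter.unusedSectionVars false

namespace ESM

/-! ### Preliminaries on tangent spaces -/

section Tangent

variable {d : ℕ} {N : Type*} [TopologicalSpace N] [ChartedSpace (EuclideanSpace ℝ (Fin d)) N]

instance instFiniteDimensionalTangent (x : N) : FiniteDimensional ℝ (TangentSpace (𝓡 d) x) :=
  inferInstanceAs (FiniteDimensional ℝ (EuclideanSpace ℝ (Fin d)))

instance instT2Tangent (x : N) : T2Space (TangentSpace (𝓡 d) x) :=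
  inferInstanceAs (T2Space (EuclideanSpace ℝ (Fin d)))

/-- A basis of the tangent space (the one given by the standard basis of the model space). All
constructions below that use it, such as metric contractions, are independent of this choice. -/
def tangentBasis (x : N) : Basis (Fin d) ℝ (TangentSpace (𝓡 d) x) :=
  (EuclideanSpace.basisFun (Fin d) ℝ).toBasis

theorem finrank_tangent (x : N) : finrank ℝ (TangentSpace (𝓡 d) x) = d :=
  (finrank_eq_card_basis (tangentBasis x)).trans (Fintype.card_fin d)

variable [IsManifold (𝓡 d) ∞ N]

/-- A vector field is smooth. -/
def SmoothVectorField (X : Π x : N, TangentSpace (𝓡 d) x) : Prop :=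
  ContMDiff (𝓡 d) ((𝓡 d).prod 𝓘(ℝ, EuclideanSpace ℝ (Fin d))) ∞
    (fun x ↦ TotalSpace.mk' (EuclideanSpace ℝ (Fin d)) x (X x))

/-! ### Musical isomorphisms and the Levi-Civita connection of a (pseudo-)Riemannian metric

Here `G x` is the bilinear form of the metric on the tangent space at `x`. -/

/-- The value of the metric, as a field of bilinear forms on tangent spaces. -/
abbrev MetricField (d : ℕ) (N : Type*) [TopologicalSpace N]
    [ChartedSpace (EuclideanSpace ℝ (Fin d)) N] :=
  Π x : N, TangentSpace (𝓡 d) x →L[ℝ] TangentSpace (𝓡 d) x →L[ℝ] ℝ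

/-- The musical isomorphism `♯ : T*N → TN`, i.e. the inverse of `v ↦ G(v, ·)`. -/
def sharp (G : MetricField d N) (x : N) :
    (TangentSpace (𝓡 d) x →L[ℝ] ℝ) →L[ℝ] TangentSpace (𝓡 d) x :=
  (G x).inverse

/-- The coefficients `G^{ij}` of the inverse metric in the basis `tangentBasis x`. -/
def invMetric (G : MetricField d N) (x : N) (i j : Fin d) : ℝ :=
  (tangentBasis x).coord j (sharp G x ((tangentBasis x).coord i).toContinuousLinearMap)

/-- The trace with respect to `G` of a bilinear map on the tangent space at `x`. -/
def metricTrace (G : MetricField d N) (x : N) {W : Type*} [AddCommGroup W] [Module ℝ W]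
    (B : TangentSpace (𝓡 d) x → TangentSpace (𝓡 d) x → W) : W :=
  ∑ i, ∑ j, invMetric G x i j • B (tangentBasis x i) (tangentBasis x j)

/-- The right hand side of the Koszul formula for `2 G(∇_X Y, Z)`. -/
def koszul (G : MetricField d N) (X Y Z : Π x : N, TangentSpace (𝓡 d) x) (x : N) : ℝ :=
  mvfderiv (𝓡 d) (fun y ↦ G y (Y y) (Z y)) x (X x)
  + mvfderiv (𝓡 d) (fun y ↦ G y (X y) (Z y)) x (Y x)
  - mvfderiv (𝓡 d) (fun y ↦ G y (X y) (Y y)) x (Z x)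
  + G x (VectorField.mlieBracket (𝓡 d) X Y x) (Z x)
  - G x (VectorField.mlieBracket (𝓡 d) X Z x) (Y x)
  - G x (VectorField.mlieBracket (𝓡 d) Y Z x) (X x)

/-- The Levi-Civita connection of `G`: `leviCivita G Y x v` is `(∇_v Y)(x)`, the vector whose
`G`-product with `w` is half the Koszul expression. Tangent vectors at `x` are
extended to vector fields that are smooth near `x`; for `Y` differentiable at `x` the Koszul
expression does not depend on the extensions. -/
def leviCivita (G : MetricField d N) (Y : Π x : N, TangentSpace (𝓡 d) x) (x : N)
    (v : TangentSpace (𝓡 d) x) : TangentSpace (𝓡 d) x :=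
  sharp G x (LinearMap.toContinuousLinearMap ((tangentBasis x).constr ℝ fun a ↦
    (1 / 2 : ℝ) * koszul G (FiberBundle.extend (EuclideanSpace ℝ (Fin d)) v) Y
      (FiberBundle.extend (EuclideanSpace ℝ (Fin d)) (tangentBasis x a)) x))

end Tangent

/-! ### Pulled-back connections -/

section Pullback

variable {m d : ℕ} {M : Type*} [TopologicalSpace M] [ChartedSpace (EuclideanSpace ℝ (Fin m)) M]
  {N : Type*} [TopologicalSpace N] [ChartedSpace (EuclideanSpace ℝ (Fin d)) N]
  (F : Type*) [NormedAddCommGroup F] [NormedSpace ℝ F] [FiniteDimensional ℝ F]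
  {S : N → Type*} [TopologicalSpace (TotalSpace F S)]
  [∀ y, AddCommGroup (S y)] [∀ y, Module ℝ (S y)] [∀ y, TopologicalSpace (S y)]
  [FiberBundle F S] [VectorBundle ℝ F S] [ContMDiffVectorBundle 1 F S (𝓡 d)]

/-- The pull-back `cov^φ` through `φ : M → N` of a connection `cov` on a vector bundle `S` over
`N`. Write a section `σ` of `φ^* S` near `x` as `σ = ∑ σⁱ (eᵢ ∘ φ)`, where `e` is a local
frame of `S` near `φ x`. Then `cov^φ_v σ = ∑ dσⁱ(v) eᵢ(φ x) + σⁱ(x) cov_{dφ(v)} eᵢ`. -/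
def pullbackCov (cov : (Π y : N, S y) → Π y : N, TangentSpace (𝓡 d) y → S y) (φ : M → N)
    (σ : Π x : M, S (φ x)) (x : M) (v : TangentSpace (𝓡 m) x) : S (φ x) :=
  let e := trivializationAt F S (φ x)
  let b := finBasis ℝ F
  ∑ i, (mvfderiv (𝓡 m) (fun x' ↦ e.localFrameCoeff (𝓡 d) b i (φ x') (σ x')) x v •
      e.localFrame b i (φ x)
    + e.localFrameCoeff (𝓡 d) b i (φ x) (σ x) •
      cov (e.localFrame b i) (φ x) (mfderiv (𝓡 m) (𝓡 d) φ x v))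

end Pullback

/-! ### Scalar structures and the modified tension field -/

/-- A scalar structure with scalar manifold `𝓜`: a smooth Riemannian metric and a smooth
potential. -/
structure ScalarStructure (d : ℕ) (𝓜 : Type*) [TopologicalSpace 𝓜]
    [ChartedSpace (EuclideanSpace ℝ (Fin d)) 𝓜] [IsManifold (𝓡 d) ∞ 𝓜] where
  metric : ContMDiffRiemannianMetric (𝓡 d) ∞ (EuclideanSpace ℝ (Fin d))
    (fun y : 𝓜 ↦ TangentSpace (𝓡 d) y)
  potential : 𝓜 → ℝ
  smooth_potential : ContMDiff (𝓡 d) 𝓘(ℝ) ∞ potential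

/-- A Lorentzian metric on a four-manifold: a smooth field of symmetric bilinear forms of
signature `(3,1)` (three positive, one negative). -/
structure LorentzianMetric (M : Type*) [TopologicalSpace M]
    [ChartedSpace (EuclideanSpace ℝ (Fin 4)) M] [IsManifold (𝓡 4) ∞ M] where
  inner : MetricField 4 M
  symm (x : M) (v w : TangentSpace (𝓡 4) x) : inner x v w = inner x w v
  signature (x : M) : ∃ b : Basis (Fin 4) ℝ (TangentSpace (𝓡 4) x),
    ∀ i j, inner x (b i) (b j) = if i = j then (if i = 0 then -1 else 1) else 0
  contMDiff : ContMDiff (𝓡 4) ((𝓡 4).prod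
      𝓘(ℝ, EuclideanSpace ℝ (Fin 4) →L[ℝ] EuclideanSpace ℝ (Fin 4) →L[ℝ] ℝ)) ∞
    (fun x ↦ TotalSpace.mk' (EuclideanSpace ℝ (Fin 4) →L[ℝ] EuclideanSpace ℝ (Fin 4) →L[ℝ] ℝ)
      (E := fun x : M ↦ TangentSpace (𝓡 4) x →L[ℝ] TangentSpace (𝓡 4) x →L[ℝ] ℝ)
      x (inner x))

/-- An orientation of a four-manifold: an orientation of each tangent space, such that around each
point there is a smooth local frame of the tangent bundle which is positively oriented. -/
structure ManifoldOrientation (M : Type*) [TopologicalSpace M]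
    [ChartedSpace (EuclideanSpace ℝ (Fin 4)) M] [IsManifold (𝓡 4) ∞ M] where
  at' (x : M) : Orientation ℝ (TangentSpace (𝓡 4) x) (Fin 4)
  locally_const (x : M) : ∃ (u : Set M) (s : Fin 4 → Π y : M, TangentSpace (𝓡 4) y)
    (hs : IsLocalFrameOn (𝓡 4) (EuclideanSpace ℝ (Fin 4)) ∞ s u),
    IsOpen u ∧ x ∈ u ∧ ∀ (y : M) (hy : y ∈ u), (hs.toBasisAt hy).orientation = at' y

section Scalar

variable {M : Type*} [TopologicalSpace M] [ChartedSpace (EuclideanSpace ℝ (Fin 4)) M]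
  [IsManifold (𝓡 4) ∞ M]
  {d : ℕ} {𝓜 : Type*} [TopologicalSpace 𝓜] [ChartedSpace (EuclideanSpace ℝ (Fin d)) 𝓜]
  [IsManifold (𝓡 d) ∞ 𝓜]

/-- The second fundamental form `(∇ dφ)(u, v) = ∇^φ_u (dφ(V)) - dφ(∇_u V)`, where `V` is a local
extension of `v`. -/
def secondFundamentalForm (g : MetricField 4 M) (G : MetricField d 𝓜) (φ : M → 𝓜) (x : M)
    (u v : TangentSpace (𝓡 4) x) : TangentSpace (𝓡 d) (φ x) :=
  pullbackCov (EuclideanSpace ℝ (Fin d)) (leviCivita G) φ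
    (fun x' ↦ mfderiv (𝓡 4) (𝓡 d) φ x'
      (FiberBundle.extend (EuclideanSpace ℝ (Fin 4)) v x')) x u
  - mfderiv (𝓡 4) (𝓡 d) φ x
      (leviCivita g (FiberBundle.extend (EuclideanSpace ℝ (Fin 4)) v) x u)

/-- The tension field `Tr_g (∇ dφ)`, a section of `φ^* T𝓜`. -/
def tensionField (g : MetricField 4 M) (G : MetricField d 𝓜) (φ : M → 𝓜) (x : M) :
    TangentSpace (𝓡 d) (φ x) :=
  metricTrace g x (secondFundamentalForm g G φ x)

/-- The gradient of a function. -/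
def gradient (G : MetricField d 𝓜) (Φ : 𝓜 → ℝ) (y : 𝓜) : TangentSpace (𝓡 d) y :=
  sharp G y (mvfderiv (𝓡 d) Φ y)

/-- The modified tension field. -/
def modifiedTension (Sig : ScalarStructure d 𝓜) (g : LorentzianMetric M) (φ : M → 𝓜) (x : M) :
    TangentSpace (𝓡 d) (φ x) :=
  tensionField g.inner Sig.metric.inner φ x - gradient Sig.metric.inner Sig.potential (φ x)

/-! ### The Hodge operator on two-forms with values in a vector space -/

/-- The volume form of an oriented Lorentzian four-manifold at `x`. -/
def volumeForm (o : ManifoldOrientation M) (g : LorentzianMetric M) (x : M) :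
    TangentSpace (𝓡 4) x [⋀^Fin 4]→ₗ[ℝ] ℝ :=
  let b : Basis (Fin 4) ℝ (TangentSpace (𝓡 4) x) := (o.at' x).someBasis
    ((Fintype.card_fin 4).trans (finrank_tangent (d := 4) x).symm)
  Real.sqrt |(Matrix.of fun i j ↦ g.inner x (b i) (b j)).det| • b.det

/-- The Hodge operator `*_g ⊗ id_W` on `W`-valued two-forms at `x`:
`(* ρ)(u, v) = ½ g^{ik} g^{jl} ρ_{ij} vol(e_k, e_l, u, v)`. -/
def hodgeStar (o : ManifoldOrientation M) (g : LorentzianMetric M) (x : M) {W : Type*}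
    [AddCommGroup W] [Module ℝ W] (ρ : TangentSpace (𝓡 4) x [⋀^Fin 2]→ₗ[ℝ] W) :
    TangentSpace (𝓡 4) x [⋀^Fin 2]→ₗ[ℝ] W :=
  let e := tangentBasis x
  (1 / 2 : ℝ) • ∑ i, ∑ j, ∑ k, ∑ l, (invMetric g.inner x i k * invMetric g.inner x j l) •
    (LinearMap.toSpanSingleton ℝ W (ρ ![e i, e j])).compAlternatingMap
      (((volumeForm o g x).curryLeft (e k)).curryLeft (e l))

/-- The scalar product induced by `g` and a bilinear form `Q` on `W` on the space of `W`-valued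
two-forms at `x`: `(α, β) = ½ g^{ik} g^{jl} Q(α_{ij}, β_{kl})`. -/
def formInner (g : LorentzianMetric M) (x : M) {W : Type*} [AddCommGroup W] [Module ℝ W]
    (Q : W →ₗ[ℝ] W →ₗ[ℝ] ℝ) (α β : TangentSpace (𝓡 4) x [⋀^Fin 2]→ₗ[ℝ] W) : ℝ :=
  let e := tangentBasis x
  (1 / 2 : ℝ) * ∑ i, ∑ j, ∑ k, ∑ l, (invMetric g.inner x i k * invMetric g.inner x j l) *
    Q (α ![e i, e j]) (β ![e k, e l])

/-- The scalar product of two-forms, extended trivially to a `T`-valued pairing between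
`W`-valued two-forms `α` and elements `Ψ β` of `T ⊗ ⋀² ⊗ W`, where `Ψ ∈ T ⊗ End(W)`;
thus `(α, (w ⊗ A) β) = (α, A β) w`. -/
def extendedFormInner (g : LorentzianMetric M) (x : M) {W T : Type*} [AddCommGroup W] [Module ℝ W]
    [AddCommGroup T] [Module ℝ T] (Q : W →ₗ[ℝ] W →ₗ[ℝ] ℝ)
    (α : TangentSpace (𝓡 4) x [⋀^Fin 2]→ₗ[ℝ] W) (Ψ : TensorProduct ℝ T (Module.End ℝ W))
    (β : TangentSpace (𝓡 4) x [⋀^Fin 2]→ₗ[ℝ] W) : T :=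
  TensorProduct.lift
    (LinearMap.mk₂ ℝ (fun (w : T) (A : Module.End ℝ W) ↦
        formInner g x Q α (A.compAlternatingMap β) • w)
      (fun w w' A ↦ smul_add _ w w')
      (fun c w A ↦ smul_comm _ c w)
      (fun w A A' ↦ by
        rw [← add_smul]; congr 1
        simp only [formInner, LinearMap.compAlternatingMap_apply, LinearMap.add_apply, map_add,
          mul_add, Finset.sum_add_distrib])
      (fun c w A ↦ by
        rw [smul_smul]; congr 1
        simp only [formInner, LinearMap.compAlternatingMap_apply, LinearMap.smul_apply, map_smul,
          smul_eq_mul, Finset.mul_sum]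
        refine Finset.sum_congr rfl fun i _ ↦ Finset.sum_congr rfl fun j _ ↦
          Finset.sum_congr rfl fun k _ ↦ Finset.sum_congr rfl fun l _ ↦ ?_
        ring)) Ψ

end Scalar

/-! ### Duality structures and electromagnetic structures -/

section Duality

variable (d : ℕ) {𝓜 : Type*} [TopologicalSpace 𝓜] [ChartedSpace (EuclideanSpace ℝ (Fin d)) 𝓜]
  [IsManifold (𝓡 d) ∞ 𝓜]
  (F : Type*) [NormedAddCommGroup F] [NormedSpace ℝ F] [FiniteDimensional ℝ F]
  (S : 𝓜 → Type*) [TopologicalSpace (TotalSpace F S)]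
  [∀ y, AddCommGroup (S y)] [∀ y, Module ℝ (S y)] [∀ y, TopologicalSpace (S y)]
  [∀ y, IsTopologicalAddGroup (S y)] [∀ y, ContinuousSMul ℝ (S y)]
  [FiberBundle F S] [VectorBundle ℝ F S] [ContMDiffVectorBundle ∞ F S (𝓡 d)]

/-- A duality structure `(S, D, ω)` with underlying vector bundle `S`: a smooth symplectic pairing
`ω` and a smooth flat connection `D` compatible with `ω`. (The value
`D σ y v` is the covariant derivative of `σ` at `y` in the direction `v`.) -/
structure DualityStructure where
  pairing (y : 𝓜) : S y →L[ℝ] S y →L[ℝ] ℝ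
  pairing_alternating (y : 𝓜) (s : S y) : pairing y s s = 0
  pairing_nondegenerate (y : 𝓜) (s : S y) : (∀ t, pairing y s t = 0) → s = 0
  pairing_smooth : ContMDiff (𝓡 d) ((𝓡 d).prod 𝓘(ℝ, F →L[ℝ] F →L[ℝ] ℝ)) ∞
    (fun y ↦ TotalSpace.mk' (F →L[ℝ] F →L[ℝ] ℝ)
      (E := fun y : 𝓜 ↦ S y →L[ℝ] S y →L[ℝ] ℝ) y (pairing y))
  D : CovariantDerivative (𝓡 d) F S
  D_smooth : CovariantDerivative.ContMDiffCovariantDerivative D ∞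
  D_compatible (s t : Π y : 𝓜, S y) (y : 𝓜) (v : TangentSpace (𝓡 d) y) :
    MDifferentiableAt (𝓡 d) ((𝓡 d).prod 𝓘(ℝ, F)) (fun y' ↦ TotalSpace.mk' F y' (s y')) y →
    MDifferentiableAt (𝓡 d) ((𝓡 d).prod 𝓘(ℝ, F)) (fun y' ↦ TotalSpace.mk' F y' (t y')) y →
    mvfderiv (𝓡 d) (fun y' ↦ pairing y' (s y') (t y')) y v
      = pairing y (D s y v) (t y) + pairing y (s y) (D t y v)
  D_flat (X Y : Π y : 𝓜, TangentSpace (𝓡 d) y) (s : Π y : 𝓜, S y) :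
    SmoothVectorField X → SmoothVectorField Y →
    ContMDiff (𝓡 d) ((𝓡 d).prod 𝓘(ℝ, F)) ∞ (fun y ↦ TotalSpace.mk' F y (s y)) →
    ∀ y : 𝓜, D (fun y' ↦ D s y' (Y y')) y (X y) - D (fun y' ↦ D s y' (X y')) y (Y y)
      - D s y (VectorField.mlieBracket (𝓡 d) X Y y) = 0

/-- An electromagnetic structure `(S, D, J, ω)`: a duality structure with a taming `J`, i.e. a
smooth complex structure `J` on `S` which preserves `ω` and for which `Q(s,t) = ω(J s, t)` is
positive definite. -/
structure ElectromagneticStructure extends DualityStructure d F S where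
  J (y : 𝓜) : S y →L[ℝ] S y
  J_sq (y : 𝓜) (s : S y) : J y (J y s) = -s
  J_symplectic (y : 𝓜) (s t : S y) : pairing y (J y s) (J y t) = pairing y s t
  J_pos (y : 𝓜) (s : S y) : s ≠ 0 → 0 < pairing y (J y s) s
  J_smooth : ContMDiff ((𝓡 d).prod 𝓘(ℝ, F)) ((𝓡 d).prod 𝓘(ℝ, F)) ∞
    (fun p : TotalSpace F S ↦ TotalSpace.mk' F p.1 (J p.1 p.2))

/-- An unbased automorphism of the vector bundle `S`: a diffeomorphism `total` of the total
space which covers a diffeomorphism `base` of `𝓜` and restricts to linear isomorphisms `fiber y`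
between the fibers. -/
structure UnbasedAut where
  base : Diffeomorph (𝓡 d) (𝓡 d) 𝓜 𝓜 ∞
  total : Diffeomorph ((𝓡 d).prod 𝓘(ℝ, F)) ((𝓡 d).prod 𝓘(ℝ, F)) (TotalSpace F S)
    (TotalSpace F S) ∞
  fiber (y : 𝓜) : S y ≃L[ℝ] S (base y)
  total_apply (y : 𝓜) (s : S y) : total ⟨y, s⟩ = ⟨base y, fiber y s⟩

variable {d F S}

/-- The adjoint action `Ad(f)(A) = f ∘ A ∘ f⁻¹` of `f` on sections of `End(S)`. -/
def UnbasedAut.Ad (f : UnbasedAut d F S) (A : Π y : 𝓜, S y →L[ℝ] S y) (y : 𝓜) : S y →L[ℝ] S y :=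
  f.base.apply_symm_apply y ▸
    (((f.fiber (f.base.symm y)).toContinuousLinearMap.comp (A (f.base.symm y))).comp
      (f.fiber (f.base.symm y)).symm.toContinuousLinearMap)

theorem UnbasedAut.Ad_base (f : UnbasedAut d F S) (A : Π y : 𝓜, S y →L[ℝ] S y) (y : 𝓜)
    (s : S y) : f.Ad A (f.base y) (f.fiber y s) = f.fiber y (A y s) := by
  have key : ∀ (z : 𝓜) (h : f.base z = f.base y),
      (h ▸ (((f.fiber z).toContinuousLinearMap.comp (A z)).comp
        (f.fiber z).symm.toContinuousLinearMap) : S (f.base y) →L[ℝ] S (f.base y))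
        (f.fiber y s) = f.fiber y (A y s) := by
    intro z h
    obtain rfl : z = y := f.base.injective h
    simp
  exact key _ _

/-- `f` is a symmetry of the duality structure: it is symplectic and covariantly constant, that
is, the section `t = f ∘ s ∘ f₀⁻¹` satisfies `D_{df₀(v)} t = f (D_v s)` for every
section `s` (differentiable where the derivative is taken). -/
structure IsDualitySymmetry (Δ : DualityStructure d F S) (f : UnbasedAut d F S) : Prop where
  symplectic (y : 𝓜) (s t : S y) : Δ.pairing (f.base y) (f.fiber y s) (f.fiber y t) = Δ.pairing y s t
  parallel (s t : Π y : 𝓜, S y) (ht : ∀ y, t (f.base y) = f.fiber y (s y))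
    (y : 𝓜) (v : TangentSpace (𝓡 d) y) :
    MDifferentiableAt (𝓡 d) ((𝓡 d).prod 𝓘(ℝ, F)) (fun y' ↦ TotalSpace.mk' F y' (s y')) y →
    Δ.D t (f.base y) (mfderiv (𝓡 d) (𝓡 d) f.base y v) = f.fiber y (Δ.D s y v)

/-- A scalar-electromagnetic duality of `(Σ, Δ)`: a symmetry `f` of the duality structure `Δ`
whose projection `f₀` to `𝓜` is an isometry which preserves the scalar potential. -/
structure IsScalarElectromagneticDuality (Sig : ScalarStructure d 𝓜) (Δ : DualityStructure d F S)
    (f : UnbasedAut d F S) : Prop extends IsDualitySymmetry Δ f where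
  isometry (y : 𝓜) (v w : TangentSpace (𝓡 d) y) :
    Sig.metric.inner (f.base y) (mfderiv (𝓡 d) (𝓡 d) f.base y v) (mfderiv (𝓡 d) (𝓡 d) f.base y w)
      = Sig.metric.inner y v w
  potential (y : 𝓜) : Sig.potential (f.base y) = Sig.potential y

/-- The electromagnetic structure `Ξ_f = (S, D, Ad(f)(J), ω)`. -/
def ElectromagneticStructure.twist (Ξ : ElectromagneticStructure d F S) (f : UnbasedAut d F S)
    (hf : ∀ (y : 𝓜) (s t : S y), Ξ.pairing (f.base y) (f.fiber y s) (f.fiber y t) = Ξ.pairing y s t) :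
    ElectromagneticStructure d F S where
  toDualityStructure := Ξ.toDualityStructure
  J := f.Ad Ξ.J
  J_sq y s := by
    obtain ⟨y, rfl⟩ := (show Function.Surjective f.base from f.base.surjective) y
    obtain ⟨s, rfl⟩ := (show Function.Surjective (f.fiber y) from (f.fiber y).surjective) s
    rw [f.Ad_base, f.Ad_base, Ξ.J_sq, map_neg]
  J_symplectic y s t := by
    obtain ⟨y, rfl⟩ := (show Function.Surjective f.base from f.base.surjective) y
    obtain ⟨s, rfl⟩ := (show Function.Surjective (f.fiber y) from (f.fiber y).surjective) s
    obtain ⟨t, rfl⟩ := (show Function.Surjective (f.fiber y) from (f.fiber y).surjective) t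
    rw [f.Ad_base, f.Ad_base, hf, hf, Ξ.J_symplectic]
  J_pos y s hs := by
    obtain ⟨y, rfl⟩ := (show Function.Surjective f.base from f.base.surjective) y
    obtain ⟨s, rfl⟩ := (show Function.Surjective (f.fiber y) from (f.fiber y).surjective) s
    rw [f.Ad_base, hf]
    exact Ξ.J_pos y s fun h ↦ hs (by rw [h, map_zero])
  J_smooth := by
    refine (f.total.contMDiff.comp (Ξ.J_smooth.comp f.total.symm.contMDiff)).congr fun p ↦ ?_
    have key : ∀ q : TotalSpace F S, f.total q = p →
        TotalSpace.mk' F p.1 (f.Ad Ξ.J p.1 p.2) = f.total (TotalSpace.mk' F q.1 (Ξ.J q.1 q.2)) := by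
      rintro ⟨y, s⟩ h
      rw [f.total_apply] at h
      subst h
      exact (congrArg (TotalSpace.mk' F (f.base y)) (f.Ad_base Ξ.J y s)).trans
        (f.total_apply y (Ξ.J y s)).symm
    exact key _ (f.total.apply_symm_apply p)

/-! ### The fundamental form and the fundamental field -/

/-- The scalar product `Q(s, t) = ω(J s, t)` on the fibers of `S`. -/
def ElectromagneticStructure.Q (Ξ : ElectromagneticStructure d F S) (y : 𝓜) :
    S y →ₗ[ℝ] S y →ₗ[ℝ] ℝ :=
  LinearMap.mk₂ ℝ (fun s t ↦ Ξ.pairing y (Ξ.J y s) t) (by simp) (by simp) (by simp) (by simp)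

/-- The operator `D ∘ J - J ∘ D` on sections of `S`, at the point `y`. -/
def ElectromagneticStructure.covJ (Ξ : ElectromagneticStructure d F S) (y : 𝓜)
    (s : Π y : 𝓜, S y) : TangentSpace (𝓡 d) y →L[ℝ] S y :=
  Ξ.D (fun y' ↦ Ξ.J y' (s y')) y - (Ξ.J y).comp (Ξ.D s y)

theorem ElectromagneticStructure.mdifferentiableAt_J (Ξ : ElectromagneticStructure d F S) {y : 𝓜}
    {s : Π y : 𝓜, S y}
    (hs : MDifferentiableAt (𝓡 d) ((𝓡 d).prod 𝓘(ℝ, F)) (fun y' ↦ TotalSpace.mk' F y' (s y')) y) :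
    MDifferentiableAt (𝓡 d) ((𝓡 d).prod 𝓘(ℝ, F))
      (fun y' ↦ TotalSpace.mk' F y' (Ξ.J y' (s y'))) y :=
  (Ξ.J_smooth.mdifferentiable (by simp) _).comp y hs

theorem ElectromagneticStructure.tensorial_covJ (Ξ : ElectromagneticStructure d F S) (y : 𝓜) :
    TensorialAt (𝓡 d) F (Ξ.covJ y) y where
  smul {h s} hh hs := by
    have e : (fun y' ↦ Ξ.J y' ((h • s) y')) = h • (fun y' ↦ Ξ.J y' (s y')) := by
      funext y'; simp
    have := Ξ.D.isCovariantDerivativeOnUniv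
    rw [covJ, covJ, e, this.leibniz hs hh, this.leibniz (Ξ.mdifferentiableAt_J hs) hh]
    ext v
    simp [smul_sub]
  add {s t} hs ht := by
    have e : (fun y' ↦ Ξ.J y' ((s + t) y'))
        = (fun y' ↦ Ξ.J y' (s y')) + (fun y' ↦ Ξ.J y' (t y')) := by
      funext y'; simp
    have := Ξ.D.isCovariantDerivativeOnUniv
    rw [covJ, covJ, covJ, e, this.add hs ht,
      this.add (Ξ.mdifferentiableAt_J hs) (Ξ.mdifferentiableAt_J ht)]
    ext v
    simp
    abel

/-- The fundamental form `Θ = D ∘ J - J ∘ D`, a one-form with values in `End(S)`: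
`fundamentalForm Ξ y v` is the endomorphism `Θ(v)` of `S y`. -/
def ElectromagneticStructure.fundamentalForm (Ξ : ElectromagneticStructure d F S) (y : 𝓜) :
    TangentSpace (𝓡 d) y →ₗ[ℝ] Module.End ℝ (S y) :=
  haveI : ContMDiffVectorBundle 1 F S (𝓡 d) := inferInstance
  LinearMap.mk₂ ℝ (fun (v : TangentSpace (𝓡 d) y) (s : S y) ↦
      TensorialAt.mkHom (Ξ.covJ y) y (Ξ.tensorial_covJ y) s v)
    (by simp) (by simp) (by simp) (by simp)

/-- The fundamental field `Ψ = (♯ ⊗ id)(Θ) ∈ T𝓜 ⊗ End(S)`. -/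
def fundamentalField (Sig : ScalarStructure d 𝓜) (Ξ : ElectromagneticStructure d F S) (y : 𝓜) :
    TensorProduct ℝ (TangentSpace (𝓡 d) y) (Module.End ℝ (S y)) :=
  LinearMap.rTensor (Module.End ℝ (S y))
    ((sharp Sig.metric.inner y).toLinearMap ∘ₗ
      (LinearMap.toContinuousLinearMap :
        (TangentSpace (𝓡 d) y →ₗ[ℝ] ℝ) ≃ₗ[ℝ] (TangentSpace (𝓡 d) y →L[ℝ] ℝ)).toLinearMap)
    ((dualTensorHomEquiv (R := ℝ) (M := TangentSpace (𝓡 d) y)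
      (N := Module.End ℝ (S y))).symm (Ξ.fundamentalForm y))

/-! ### Scalar-electromagnetic configurations and solutions -/

section Fields

variable {M : Type*} [TopologicalSpace M] [ChartedSpace (EuclideanSpace ℝ (Fin 4)) M]
  [IsManifold (𝓡 4) ∞ M]

variable (d F S M) in
/-- A pair `(φ, V)` of a smooth map `φ : M → 𝓜` and a smooth two-form `V` on `M` with
values in `φ^* S`. Smoothness of `V` is smoothness of `V(X, Y)` for all smooth vector fields. -/
structure FieldPair where
  φ : ContMDiffMap (𝓡 4) (𝓡 d) M 𝓜 ∞
  V (x : M) : TangentSpace (𝓡 4) x [⋀^Fin 2]→ₗ[ℝ] S (φ x)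
  smooth_V (X Y : Π x : M, TangentSpace (𝓡 4) x) : SmoothVectorField X → SmoothVectorField Y →
    ContMDiff (𝓡 4) ((𝓡 d).prod 𝓘(ℝ, F)) ∞ (fun x ↦ TotalSpace.mk' F (φ x) (V x ![X x, Y x]))

/-- The twisted Hodge operator `⋆ = *_g ⊗ J^φ` at `x`. -/
def twistedHodge (o : ManifoldOrientation M) (g : LorentzianMetric M)
    (Ξ : ElectromagneticStructure d F S) (φ : M → 𝓜) (x : M)
    (η : TangentSpace (𝓡 4) x [⋀^Fin 2]→ₗ[ℝ] S (φ x)) :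
    TangentSpace (𝓡 4) x [⋀^Fin 2]→ₗ[ℝ] S (φ x) :=
  hodgeStar o g x ((Ξ.J (φ x)).toLinearMap.compAlternatingMap η)

/-- The twisted exterior differential `d_{D^φ}` of an `S^φ`-valued two-form, evaluated on three
vector fields, where `D^φ` is the pulled-back connection. -/
def twistedExteriorDerivative (Δ : DualityStructure d F S) (φ : M → 𝓜)
    (V : Π x : M, TangentSpace (𝓡 4) x [⋀^Fin 2]→ₗ[ℝ] S (φ x))
    (X Y Z : Π x : M, TangentSpace (𝓡 4) x) (x : M) : S (φ x) :=
  haveI : ContMDiffVectorBundle 1 F S (𝓡 d) := inferInstance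
  pullbackCov F (fun s y v ↦ Δ.D s y v) φ (fun x' ↦ V x' ![Y x', Z x']) x (X x)
  - pullbackCov F (fun s y v ↦ Δ.D s y v) φ (fun x' ↦ V x' ![X x', Z x']) x (Y x)
  + pullbackCov F (fun s y v ↦ Δ.D s y v) φ (fun x' ↦ V x' ![X x', Y x']) x (Z x)
  - V x ![VectorField.mlieBracket (𝓡 4) X Y x, Z x]
  + V x ![VectorField.mlieBracket (𝓡 4) X Z x, Y x]
  - V x ![VectorField.mlieBracket (𝓡 4) Y Z x, X x]

/-- The set `Conf^g_𝒟(M)` of global scalar-electromagnetic configurations of type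
`𝒟 = (Sig, Ξ)`: the two-form `V` is positively polarized. -/
def Conf (o : ManifoldOrientation M) (g : LorentzianMetric M)
    (Ξ : ElectromagneticStructure d F S) : Set (FieldPair d F S M) :=
  {p | ∀ x, twistedHodge o g Ξ p.φ x (p.V x) = p.V x}

/-- The scalar equations `θ_Σ(g, φ) - ½ (* V, Ψ^φ V) = 0`. -/
def ScalarEquation (o : ManifoldOrientation M) (g : LorentzianMetric M) (Sig : ScalarStructure d 𝓜)
    (Ξ : ElectromagneticStructure d F S) (p : FieldPair d F S M) : Prop :=
  ∀ x, modifiedTension Sig g p.φ x - (1 / 2 : ℝ) •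
    extendedFormInner g x (Ξ.Q (p.φ x)) (hodgeStar o g x (p.V x))
      (fundamentalField Sig Ξ (p.φ x)) (p.V x) = 0

/-- The twisted electromagnetic equations `d_{D^φ} V = 0`. -/
def ElectromagneticEquation (Δ : DualityStructure d F S) (p : FieldPair d F S M) : Prop :=
  ∀ X Y Z : Π x : M, TangentSpace (𝓡 4) x,
    SmoothVectorField X → SmoothVectorField Y → SmoothVectorField Z →
    ∀ x, twistedExteriorDerivative Δ p.φ p.V X Y Z x = 0

/-- The set `Sol^g_𝒟(M)` of global scalar-electromagnetic solutions of type `𝒟 = (Sig, Ξ)`. -/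
def Sol (o : ManifoldOrientation M) (g : LorentzianMetric M) (Sig : ScalarStructure d 𝓜)
    (Ξ : ElectromagneticStructure d F S) : Set (FieldPair d F S M) :=
  {p | p ∈ Conf o g Ξ ∧ ScalarEquation o g Sig Ξ p ∧
    ElectromagneticEquation Ξ.toDualityStructure p}

/-- The duality action `f ⋄ (φ, V) = (f₀ ∘ φ, f̂^φ(V))`. -/
def UnbasedAut.act (f : UnbasedAut d F S) (p : FieldPair d F S M) : FieldPair d F S M where
  φ := ⟨fun x ↦ f.base (p.φ x), f.base.contMDiff.comp p.φ.contMDiff⟩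
  V x := (f.fiber (p.φ x)).toLinearMap.compAlternatingMap (p.V x)
  smooth_V X Y hX hY := by
    refine (f.total.contMDiff.comp (p.smooth_V X Y hX hY)).congr fun x ↦ ?_
    exact (f.total_apply _ _).symm

end Fields

end Duality

end ESM

end

/-! Each equation is natural under `f`: the left side for `f ⋄ (φ, V)` and the twisted structure is
the image, under a fibre of `f` or under `df₀`, of the left side for `(φ, V)` and the original
structure. These maps are linear isomorphisms, so one side vanishes exactly when the other does, and
a pair solves the original system iff its image solves the twisted one (`act_mem_Sol_iff`). The
action is a bijection on all pairs, so it restricts to a bijection of solution sets.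

Polarization is natural because `f` intertwines `J` with `Ad(f)(J)` and the Hodge operator touches
only the form part. The coupling term is natural because `f` carries `Q` and `Θ` to those of the
twisted structure, and `♯` is natural under isometries.

The analytic core is `pullbackCov_fiber`: pulling back a connection commutes with any bundle
automorphism that preserves the connection. It is used twice: for `D` on `S`, giving the
electromagnetic equation, and for the Levi-Civita connection on `T𝓜` with the automorphism `df₀`,
giving the tension field. The second use rests on `leviCivita_push`, invariance under isometries,
which follows from the Koszul formula. -/

noncomputable section

set_option linter.unusedSectionVars false

namespace ESM

/-! ### Push-forward of sections by a bundle automorphism. -/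

section PushForward

variable {d : ℕ} {𝓜 : Type*} [TopologicalSpace 𝓜] [ChartedSpace (EuclideanSpace ℝ (Fin d)) 𝓜]
  [IsManifold (𝓡 d) ∞ 𝓜]
  {F : Type*} [NormedAddCommGroup F] [NormedSpace ℝ F] [FiniteDimensional ℝ F]
  {S : 𝓜 → Type*} [TopologicalSpace (TotalSpace F S)]
  [∀ y, AddCommGroup (S y)] [∀ y, Module ℝ (S y)] [∀ y, TopologicalSpace (S y)]
  [∀ y, IsTopologicalAddGroup (S y)] [∀ y, ContinuousSMul ℝ (S y)]
  [FiberBundle F S] [VectorBundle ℝ F S] [ContMDiffVectorBundle ∞ F S (𝓡 d)]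

/-- The push-forward `f ∘ s ∘ f₀⁻¹` of a section `s`. -/
def UnbasedAut.push (f : UnbasedAut d F S) (s : Π y : 𝓜, S y) (y : 𝓜) : S y :=
  f.base.apply_symm_apply y ▸ f.fiber (f.base.symm y) (s (f.base.symm y))

/-- Seen in the total space, the push-forward is a composite of maps with no transport between
fibres; differentiability is read off from this form. -/
theorem UnbasedAut.mk_push (f : UnbasedAut d F S) (s : Π y : 𝓜, S y) (y : 𝓜) :
    TotalSpace.mk' F y (f.push s y) =
      f.total (TotalSpace.mk' F (f.base.symm y) (s (f.base.symm y))) := by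
  -- The base point is generalized to `z` so that the equation `f.base z = y` can be substituted and
  -- the transport disappears.
  have key : ∀ (z : 𝓜) (h : f.base z = y),
      TotalSpace.mk' F y (h ▸ f.fiber z (s z) : S y) = f.total (TotalSpace.mk' F z (s z)) := by
    rintro z rfl
    exact (f.total_apply z (s z)).symm
  exact key _ _

@[simp]
theorem UnbasedAut.push_base (f : UnbasedAut d F S) (s : Π y : 𝓜, S y) (y : 𝓜) :
    f.push s (f.base y) = f.fiber y (s y) := by
  have h := f.mk_push s (f.base y)
  rw [f.base.symm_apply_apply] at h
  exact TotalSpace.mk_inj.1 (h.trans (f.total_apply y (s y)))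

theorem UnbasedAut.mdifferentiableAt_push (f : UnbasedAut d F S) {s : Π y : 𝓜, S y} {y : 𝓜}
    (hs : MDifferentiableAt (𝓡 d) ((𝓡 d).prod 𝓘(ℝ, F)) (fun y' ↦ TotalSpace.mk' F y' (s y')) y) :
    MDifferentiableAt (𝓡 d) ((𝓡 d).prod 𝓘(ℝ, F))
      (fun y' ↦ TotalSpace.mk' F y' (f.push s y')) (f.base y) := by
  simp only [f.mk_push]
  have h1 : MDifferentiableAt (𝓡 d) (𝓡 d) f.base.symm (f.base y) :=
    f.base.symm.mdifferentiable (by simp) _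
  have h2 : MDifferentiableAt (𝓡 d) ((𝓡 d).prod 𝓘(ℝ, F)) (fun y' ↦ TotalSpace.mk' F y' (s y'))
      (f.base.symm (f.base y)) := by rwa [f.base.symm_apply_apply]
  exact (f.total.mdifferentiable (by simp) _).comp (f.base y) (h2.comp (f.base y) h1)

end PushForward

/-! ### Pulled-back connections in arbitrary local expansions. -/

section PullbackConnection

variable {m d : ℕ} {M : Type*} [TopologicalSpace M] [ChartedSpace (EuclideanSpace ℝ (Fin m)) M]
  {N : Type*} [TopologicalSpace N] [ChartedSpace (EuclideanSpace ℝ (Fin d)) N]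
  {F : Type*} [NormedAddCommGroup F] [NormedSpace ℝ F]
  {S : N → Type*} [TopologicalSpace (TotalSpace F S)]
  [∀ y, AddCommGroup (S y)] [∀ y, Module ℝ (S y)] [∀ y, TopologicalSpace (S y)]
  [FiberBundle F S]

variable (F) in
/-- An operator which is additive and satisfies the Leibniz rule, one tangent vector at a time. No
linearity in the tangent vector is required. -/
structure IsDirectionalConnection
    (cov : (Π y : N, S y) → Π y : N, TangentSpace (𝓡 d) y → S y) : Prop where
  add {s t : Π y : N, S y} {y : N} (v : TangentSpace (𝓡 d) y) :
    MDifferentiableAt (𝓡 d) ((𝓡 d).prod 𝓘(ℝ, F)) (fun y' ↦ TotalSpace.mk' F y' (s y')) y →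
    MDifferentiableAt (𝓡 d) ((𝓡 d).prod 𝓘(ℝ, F)) (fun y' ↦ TotalSpace.mk' F y' (t y')) y →
    cov (s + t) y v = cov s y v + cov t y v
  leibniz {h : N → ℝ} {s : Π y : N, S y} {y : N} (v : TangentSpace (𝓡 d) y) :
    MDifferentiableAt (𝓡 d) 𝓘(ℝ) h y →
    MDifferentiableAt (𝓡 d) ((𝓡 d).prod 𝓘(ℝ, F)) (fun y' ↦ TotalSpace.mk' F y' (s y')) y →
    cov (h • s) y v = h y • cov s y v + mvfderiv (𝓡 d) h y v • s y

theorem mvfderiv_fun_sum_apply {ι : Type*} {I : Finset ι} {c : ι → M → ℝ} {x : M}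
    (hc : ∀ i, MDifferentiableAt (𝓡 m) 𝓘(ℝ) (c i) x) (v : TangentSpace (𝓡 m) x) :
    mvfderiv (𝓡 m) (fun x' ↦ ∑ i ∈ I, c i x') x v = ∑ i ∈ I, mvfderiv (𝓡 m) (c i) x v := by
  classical
  have key : MDifferentiableAt (𝓡 m) 𝓘(ℝ) (fun x' ↦ ∑ i ∈ I, c i x') x ∧
      mvfderiv (𝓡 m) (fun x' ↦ ∑ i ∈ I, c i x') x v = ∑ i ∈ I, mvfderiv (𝓡 m) (c i) x v := by
    induction I using Finset.induction_on with
    | empty => exact ⟨by simpa using mdifferentiableAt_const, by simp [mvfderiv_const]⟩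
    | insert i I hi ih =>
      simp only [Finset.sum_insert hi, ← ih.2]
      refine ⟨(hc i).add ih.1, ?_⟩
      rw [mvfderiv_fun_add (hc i) ih.1]
      rfl
  exact key.2

theorem localFrameCoeff_apply_eq [VectorBundle ℝ F S] [ContMDiffVectorBundle 1 F S (𝓡 d)]
    {e : Trivialization F (TotalSpace.proj : TotalSpace F S → N)} [MemTrivializationAtlas e]
    {ι : Type*} (b : Basis ι ℝ F) {y : N} (hy : y ∈ e.baseSet) (w : S y) (i : ι) :
    e.localFrameCoeff (𝓡 d) b i y w = b.repr (e (TotalSpace.mk' F y w)).2 i := by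
  have h := e.localFrameCoeff_eq_coeff (I := 𝓡 d) (b := b) (s := FiberBundle.extend F w) hy (i := i)
  simpa using h

theorem sum_localFrameCoeff_smul [VectorBundle ℝ F S] [ContMDiffVectorBundle 1 F S (𝓡 d)]
    {e : Trivialization F (TotalSpace.proj : TotalSpace F S → N)} [MemTrivializationAtlas e]
    {ι : Type*} [Fintype ι] (b : Basis ι ℝ F) {y : N} (hy : y ∈ e.baseSet) (w : S y) :
    ∑ i, e.localFrameCoeff (𝓡 d) b i y w • e.localFrame b i y = w := by
  have h := e.eq_sum_localFrameCoeff_smul (I := 𝓡 d) (b := b) (s := FiberBundle.extend F w) hy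
  simpa using h.symm

namespace IsDirectionalConnection

variable {cov : (Π y : N, S y) → Π y : N, TangentSpace (𝓡 d) y → S y}

/-- Locality follows from the Leibniz rule alone, without a smooth bump function: the indicator `ψ`
of the set where `s` and `t` agree is constant near `y`, so it is differentiable there with
derivative zero, while `ψ • s = ψ • t` holds everywhere. -/
theorem congr_of_eventuallyEq (hcov : IsDirectionalConnection F cov) {s t : Π y : N, S y} {y : N}
    (v : TangentSpace (𝓡 d) y)
    (hs : MDifferentiableAt (𝓡 d) ((𝓡 d).prod 𝓘(ℝ, F)) (fun y' ↦ TotalSpace.mk' F y' (s y')) y)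
    (ht : MDifferentiableAt (𝓡 d) ((𝓡 d).prod 𝓘(ℝ, F)) (fun y' ↦ TotalSpace.mk' F y' (t y')) y)
    (hst : ∀ᶠ y' in 𝓝 y, s y' = t y') : cov s y v = cov t y v := by
  classical
  let ψ (y' : N) : ℝ := if s y' = t y' then 1 else 0
  have hψy : ψ y = 1 := by simp [ψ, hst.self_of_nhds]
  have hψst : ψ • s = ψ • t := by
    funext y'
    by_cases h : s y' = t y' <;> simp [ψ, h]
  have hψ : HasMFDerivAt (𝓡 d) 𝓘(ℝ) ψ y 0 :=
    (hasMFDerivAt_const (1 : ℝ) y).congr_of_eventuallyEq (hst.mono fun y' hy' ↦ by simp [ψ, hy'])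
  have key : ∀ u : Π y : N, S y,
      MDifferentiableAt (𝓡 d) ((𝓡 d).prod 𝓘(ℝ, F)) (fun y' ↦ TotalSpace.mk' F y' (u y')) y →
      cov (ψ • u) y v = cov u y v := fun u hu ↦ by
    rw [hcov.leibniz v hψ.mdifferentiableAt hu, hψy, mvfderiv, hψ.mfderiv]
    simp
  rw [← key s hs, ← key t ht, hψst]

variable [VectorBundle ℝ F S]

theorem zero (hcov : IsDirectionalConnection F cov) (y : N) (v : TangentSpace (𝓡 d) y) :
    cov 0 y v = 0 := by
  have h0 : MDifferentiableAt (𝓡 d) ((𝓡 d).prod 𝓘(ℝ, F))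
      (fun y' ↦ TotalSpace.mk' F y' ((0 : Π y : N, S y) y')) y :=
    mdifferentiableAt_zeroSection ℝ S
  simpa using hcov.add v h0 h0

theorem sum_smul (hcov : IsDirectionalConnection F cov) {ι : Type*} (I : Finset ι)
    {a : ι → N → ℝ} {s : ι → Π y : N, S y} {y : N} (v : TangentSpace (𝓡 d) y)
    (ha : ∀ i, MDifferentiableAt (𝓡 d) 𝓘(ℝ) (a i) y)
    (hs : ∀ i, MDifferentiableAt (𝓡 d) ((𝓡 d).prod 𝓘(ℝ, F))
      (fun y' ↦ TotalSpace.mk' F y' (s i y')) y) :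
    cov (fun y' ↦ ∑ i ∈ I, a i y' • s i y') y v =
      ∑ i ∈ I, (a i y • cov (s i) y v + mvfderiv (𝓡 d) (a i) y v • s i y) := by
  classical
  induction I using Finset.induction_on with
  | empty =>
    simp only [Finset.sum_empty]
    exact hcov.zero y v
  | insert i I hi ih =>
    have hI : MDifferentiableAt (𝓡 d) ((𝓡 d).prod 𝓘(ℝ, F))
        (fun y' ↦ TotalSpace.mk' F y' (∑ j ∈ I, a j y' • s j y')) y :=
      .sum_section fun j _ ↦ (ha j).smul_section (hs j)
    rw [Finset.sum_insert hi, ← ih, ← hcov.leibniz v (ha i) (hs i),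
      ← hcov.add v ((ha i).smul_section (hs i)) hI]
    congr 1
    funext y'
    simp [Finset.sum_insert hi]

variable [FiniteDimensional ℝ F] [ContMDiffVectorBundle 1 F S (𝓡 d)]

/-- The pull-back connection can be computed in any local expansion of the section. -/
theorem pullbackCov_eq_sum (hcov : IsDirectionalConnection F cov) {φ : M → N} {x : M}
    (hφ : MDifferentiableAt (𝓡 m) (𝓡 d) φ x) {ι : Type*} [Fintype ι] {s : ι → Π y : N, S y}
    (hs : ∀ i, MDifferentiableAt (𝓡 d) ((𝓡 d).prod 𝓘(ℝ, F))
      (fun y' ↦ TotalSpace.mk' F y' (s i y')) (φ x))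
    {c : ι → M → ℝ} (hc : ∀ i, MDifferentiableAt (𝓡 m) 𝓘(ℝ) (c i) x) {σ : Π x : M, S (φ x)}
    (hσ : ∀ᶠ x' in 𝓝 x, σ x' = ∑ i, c i x' • s i (φ x')) (v : TangentSpace (𝓡 m) x) :
    pullbackCov F cov φ σ x v = ∑ i, (mvfderiv (𝓡 m) (c i) x v • s i (φ x) +
      c i x • cov (s i) (φ x) (mfderiv (𝓡 m) (𝓡 d) φ x v)) := by
  let e := trivializationAt F S (φ x)
  let b := finBasis ℝ F
  have he : φ x ∈ e.baseSet := FiberBundle.mem_baseSet_trivializationAt F S (φ x)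
  -- Change of frame: `a i j` are the coefficients of `s i` in the frame used to define
  -- `pullbackCov`.
  let a (i : ι) (j : Fin (finrank ℝ F)) (y : N) : ℝ := e.localFrameCoeff (𝓡 d) b j y (s i y)
  have ha (i j) : MDifferentiableAt (𝓡 d) 𝓘(ℝ) (a i j) (φ x) :=
    mdifferentiableAt_localFrameCoeff b he (hs i) j
  have hfr (j) : MDifferentiableAt (𝓡 d) ((𝓡 d).prod 𝓘(ℝ, F))
      (fun y' ↦ TotalSpace.mk' F y' (e.localFrame b j y')) (φ x) :=
    (contMDiffAt_localFrame_of_mem 1 e b j he).mdifferentiableAt one_ne_zero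
  have hexp (i) : ∀ᶠ y in 𝓝 (φ x), s i y = ∑ j, a i j y • e.localFrame b j y :=
    e.eventually_eq_localFrame_sum_coeff_smul b he
  have hcovs (i) (w : TangentSpace (𝓡 d) (φ x)) : cov (s i) (φ x) w =
      ∑ j, (a i j (φ x) • cov (e.localFrame b j) (φ x) w +
        mvfderiv (𝓡 d) (a i j) (φ x) w • e.localFrame b j (φ x)) := by
    rw [← hcov.sum_smul Finset.univ w (ha i) hfr]
    -- The expansion in the frame holds only near `φ x`, so locality of `cov` is needed.
    exact hcov.congr_of_eventuallyEq w (hs i)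
      (.sum_section fun j _ ↦ (ha i j).smul_section (hfr j)) (hexp i)
  have hcoeff (j) : (fun x' ↦ e.localFrameCoeff (𝓡 d) b j (φ x') (σ x')) =ᶠ[𝓝 x]
      fun x' ↦ ∑ i, c i x' * a i j (φ x') := hσ.mono fun x' hx' ↦ by
    simp only [hx', map_sum, map_smul, smul_eq_mul, a]
  have haφ (i j) : MDifferentiableAt (𝓡 m) 𝓘(ℝ) (fun x' ↦ a i j (φ x')) x :=
    (ha i j).comp x hφ
  have hd (j) : mvfderiv (𝓡 m) (fun x' ↦ e.localFrameCoeff (𝓡 d) b j (φ x') (σ x')) x v =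
      ∑ i, (c i x * mvfderiv (𝓡 d) (a i j) (φ x) (mfderiv (𝓡 m) (𝓡 d) φ x v) +
        a i j (φ x) * mvfderiv (𝓡 m) (c i) x v) := by
    rw [mvfderiv, (hcoeff j).mfderiv_eq]
    change mvfderiv (𝓡 m) (fun x' ↦ ∑ i, c i x' * a i j (φ x')) x v = _
    have hmul (i) : MDifferentiableAt (𝓡 m) 𝓘(ℝ) (fun x' ↦ c i x' * a i j (φ x')) x :=
      (hc i).mul (haφ i j)
    rw [mvfderiv_fun_sum_apply hmul]
    refine Finset.sum_congr rfl fun i _ ↦ ?_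
    rw [mvfderiv_fun_mul (hc i) (haφ i j)]
    have hchain : mvfderiv (𝓡 m) (fun x' ↦ a i j (φ x')) x v =
        mvfderiv (𝓡 d) (a i j) (φ x) (mfderiv (𝓡 m) (𝓡 d) φ x v) :=
      mvfderiv_comp_apply x (ha i j) hφ v
    simp [hchain]
  have hs0 (i) : s i (φ x) = ∑ j, a i j (φ x) • e.localFrame b j (φ x) :=
    (hexp i).self_of_nhds
  change ∑ j, (mvfderiv (𝓡 m) (fun x' ↦ e.localFrameCoeff (𝓡 d) b j (φ x') (σ x')) x v •
      e.localFrame b j (φ x) + e.localFrameCoeff (𝓡 d) b j (φ x) (σ x) •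
      cov (e.localFrame b j) (φ x) (mfderiv (𝓡 m) (𝓡 d) φ x v)) = _
  simp only [hd, (hcoeff _).self_of_nhds, hcovs, hs0, Finset.sum_smul, Finset.smul_sum,
    ← Finset.sum_add_distrib]
  -- After the product and chain rules, both sides are double sums over `i` and `j` of the same
  -- three terms.
  rw [Finset.sum_comm]
  refine Finset.sum_congr rfl fun i _ ↦ Finset.sum_congr rfl fun j _ ↦ ?_
  module

end IsDirectionalConnection

end PullbackConnection

/-! ### Naturality of the pulled-back connection under bundle automorphisms. -/

section PullbackNaturality

variable {m d : ℕ} {M : Type*} [TopologicalSpace M] [ChartedSpace (EuclideanSpace ℝ (Fin m)) M]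
  {𝓜 : Type*} [TopologicalSpace 𝓜] [ChartedSpace (EuclideanSpace ℝ (Fin d)) 𝓜]
  [IsManifold (𝓡 d) ∞ 𝓜]
  {F : Type*} [NormedAddCommGroup F] [NormedSpace ℝ F] [FiniteDimensional ℝ F]
  {S : 𝓜 → Type*} [TopologicalSpace (TotalSpace F S)]
  [∀ y, AddCommGroup (S y)] [∀ y, Module ℝ (S y)] [∀ y, TopologicalSpace (S y)]
  [∀ y, IsTopologicalAddGroup (S y)] [∀ y, ContinuousSMul ℝ (S y)]
  [FiberBundle F S] [VectorBundle ℝ F S] [ContMDiffVectorBundle ∞ F S (𝓡 d)]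
  [ContMDiffVectorBundle 1 F S (𝓡 d)]

/-- The left side is defined by the chosen frame at `f₀ (φ x)`, which need not be the push-forward
of the one at `φ x`. By `pullbackCov_eq_sum` the pushed frame may be used instead; in it the image
of `σ` has the same coefficients as `σ`, so the two sums agree term by term by `hf` and the chain
rule. -/
theorem pullbackCov_fiber {cov : (Π y : 𝓜, S y) → Π y : 𝓜, TangentSpace (𝓡 d) y → S y}
    (hcov : IsDirectionalConnection F cov) (f : UnbasedAut d F S)
    (hf : ∀ (s : Π y : 𝓜, S y) (y : 𝓜) (v : TangentSpace (𝓡 d) y),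
      MDifferentiableAt (𝓡 d) ((𝓡 d).prod 𝓘(ℝ, F)) (fun y' ↦ TotalSpace.mk' F y' (s y')) y →
      cov (f.push s) (f.base y) (mfderiv (𝓡 d) (𝓡 d) f.base y v) = f.fiber y (cov s y v))
    {φ : M → 𝓜} {σ : Π x : M, S (φ x)} {x : M}
    (hσ : MDifferentiableAt (𝓡 m) ((𝓡 d).prod 𝓘(ℝ, F)) (fun x' ↦ TotalSpace.mk' F (φ x') (σ x')) x)
    (v : TangentSpace (𝓡 m) x) :
    pullbackCov F cov (fun x' ↦ f.base (φ x')) (fun x' ↦ f.fiber (φ x') (σ x')) x v =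
      f.fiber (φ x) (pullbackCov F cov φ σ x v) := by
  let e := trivializationAt F S (φ x)
  let b := finBasis ℝ F
  have he : φ x ∈ e.baseSet := FiberBundle.mem_baseSet_trivializationAt F S (φ x)
  obtain ⟨hφ, hσ'⟩ := (mdifferentiableAt_totalSpace _ _).1 hσ
  have hfr (j) : MDifferentiableAt (𝓡 d) ((𝓡 d).prod 𝓘(ℝ, F))
      (fun y' ↦ TotalSpace.mk' F y' (e.localFrame b j y')) (φ x) :=
    (contMDiffAt_localFrame_of_mem 1 e b j he).mdifferentiableAt one_ne_zero
  have hnear : ∀ᶠ x' in 𝓝 x, φ x' ∈ e.baseSet :=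
    hφ.continuousAt.eventually (e.open_baseSet.mem_nhds he)
  have hc (i) : MDifferentiableAt (𝓡 m) 𝓘(ℝ)
      (fun x' ↦ e.localFrameCoeff (𝓡 d) b i (φ x') (σ x')) x := by
    have hlin : MDifferentiableAt 𝓘(ℝ, F) 𝓘(ℝ) (b.coord i).toContinuousLinearMap
        (e (TotalSpace.mk' F (φ x) (σ x))).2 :=
      (b.coord i).toContinuousLinearMap.differentiableAt.mdifferentiableAt
    refine (hlin.comp x hσ').congr_of_eventuallyEq (hnear.mono fun x' hx' ↦ ?_)
    exact localFrameCoeff_apply_eq b hx' (σ x') i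
  have hexp : ∀ᶠ x' in 𝓝 x, f.fiber (φ x') (σ x') =
      ∑ i, e.localFrameCoeff (𝓡 d) b i (φ x') (σ x') •
        f.push (e.localFrame b i) (f.base (φ x')) := hnear.mono fun x' hx' ↦ by
    simp only [f.push_base, ← map_smul, ← map_sum]
    rw [sum_localFrameCoeff_smul b hx']
  have hbase : MDifferentiableAt (𝓡 d) (𝓡 d) f.base (φ x) :=
    f.base.mdifferentiable (by simp) _
  have hcomp : MDifferentiableAt (𝓡 m) (𝓡 d) (fun x' ↦ f.base (φ x')) x := hbase.comp x hφ
  rw [hcov.pullbackCov_eq_sum hcomp (fun i ↦ f.mdifferentiableAt_push (hfr i)) hc hexp]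
  have hchain : mfderiv (𝓡 m) (𝓡 d) (fun x' ↦ f.base (φ x')) x v =
      mfderiv (𝓡 d) (𝓡 d) f.base (φ x) (mfderiv (𝓡 m) (𝓡 d) φ x v) :=
    mfderiv_comp_apply x hbase hφ v
  simp only [hchain, f.push_base, hf _ _ _ (hfr _)]
  simp only [pullbackCov, map_sum, map_add, map_smul]
  rfl

end PullbackNaturality

/-! ### The Koszul formula, and invariance of the Levi-Civita connection under isometries. -/

section LeviCivita

variable {d : ℕ} {N : Type*} [TopologicalSpace N] [ChartedSpace (EuclideanSpace ℝ (Fin d)) N]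
  [IsManifold (𝓡 d) ∞ N]

/-- A vector field is differentiable at a point. -/
abbrev DifferentiableFieldAt (X : Π y : N, TangentSpace (𝓡 d) y) (y : N) : Prop :=
  MDifferentiableAt (𝓡 d) ((𝓡 d).prod 𝓘(ℝ, EuclideanSpace ℝ (Fin d)))
    (fun y' ↦ TotalSpace.mk' (EuclideanSpace ℝ (Fin d)) y' (X y')) y

/-- The automorphism of the tangent bundle given by the differential of a diffeomorphism. -/
def tangentAut (f : Diffeomorph (𝓡 d) (𝓡 d) N N ∞) :
    UnbasedAut d (EuclideanSpace ℝ (Fin d)) (fun y : N ↦ TangentSpace (𝓡 d) y) where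
  base := f
  total :=
    { toFun := tangentMap (𝓡 d) (𝓡 d) f
      invFun := tangentMap (𝓡 d) (𝓡 d) f.symm
      left_inv := fun p ↦ by
        have h := tangentMap_comp_at p (f.symm.mdifferentiable (by simp) _)
          (f.mdifferentiable (by simp) _)
        rw [← h]
        have : f.symm ∘ f = id := funext f.symm_apply_apply
        rw [this, tangentMap_id]
        rfl
      right_inv := fun p ↦ by
        have h := tangentMap_comp_at p (f.mdifferentiable (by simp) _)
          (f.symm.mdifferentiable (by simp) _)
        rw [← h]
        have : f ∘ f.symm = id := funext f.apply_symm_apply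
        rw [this, tangentMap_id]
        rfl
      contMDiff_toFun := f.contMDiff.contMDiff_tangentMap le_rfl
      contMDiff_invFun := f.symm.contMDiff.contMDiff_tangentMap le_rfl }
  fiber y := f.mfderivToContinuousLinearEquiv (by simp) y
  total_apply _ _ := rfl

/-- The push-forward of vector fields is inverse to the pull-back. -/
theorem mpullback_push (f : Diffeomorph (𝓡 d) (𝓡 d) N N ∞) (X : Π y : N, TangentSpace (𝓡 d) y) :
    VectorField.mpullback (𝓡 d) (𝓡 d) f ((tangentAut f).push X) = X := by
  funext y
  rw [VectorField.mpullback_apply]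
  have h : (tangentAut f).push X (f y) = (tangentAut f).fiber y (X y) :=
    (tangentAut f).push_base X y
  rw [h, ← f.mfderivToContinuousLinearEquiv_coe (by simp), ContinuousLinearMap.inverse_equiv]
  exact ((tangentAut f).fiber y).symm_apply_apply (X y)

/-- Naturality of the bracket under pull-back is applied to the pushed fields, and `mpullback_push`
undoes the push. -/
theorem mlieBracket_push (f : Diffeomorph (𝓡 d) (𝓡 d) N N ∞) {X Y : Π y : N, TangentSpace (𝓡 d) y}
    {y : N} (hX : DifferentiableFieldAt X y) (hY : DifferentiableFieldAt Y y) :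
    VectorField.mlieBracket (𝓡 d) ((tangentAut f).push X) ((tangentAut f).push Y) (f y) =
      mfderiv (𝓡 d) (𝓡 d) f y (VectorField.mlieBracket (𝓡 d) X Y y) := by
  have hle : minSmoothness ℝ 2 ≤ ∞ := by
    rw [minSmoothness_of_isRCLikeNormedField]
    exact WithTop.coe_le_coe.2 le_top
  have : IsManifold (𝓡 d) (minSmoothness ℝ 2) N := .of_le hle
  have h := VectorField.mpullback_mlieBracket (n := ∞) ((tangentAut f).mdifferentiableAt_push hX)
    ((tangentAut f).mdifferentiableAt_push hY) (x₀ := y) (f := f) f.contMDiffAt hle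
  rw [mpullback_push, mpullback_push, VectorField.mpullback_apply,
    ← f.mfderivToContinuousLinearEquiv_coe (by simp), ContinuousLinearMap.inverse_equiv] at h
  rw [← h, ← f.mfderivToContinuousLinearEquiv_coe (by simp)]
  exact (((tangentAut f).fiber y).apply_symm_apply _).symm

variable (g : ContMDiffRiemannianMetric (𝓡 d) ∞ (EuclideanSpace ℝ (Fin d))
    (fun y : N ↦ TangentSpace (𝓡 d) y))

theorem mdifferentiableAt_metric {X Y : Π y : N, TangentSpace (𝓡 d) y} {y : N}
    (hX : DifferentiableFieldAt X y) (hY : DifferentiableFieldAt Y y) :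
    MDifferentiableAt (𝓡 d) 𝓘(ℝ) (fun y ↦ g.inner y (X y) (Y y)) y := by
  have h := (g.contMDiff.mdifferentiable (by simp) y).clm_bundle_apply₂
    (F₁ := EuclideanSpace ℝ (Fin d)) (F₂ := EuclideanSpace ℝ (Fin d)) hX hY
  exact ((mdifferentiableAt_totalSpace _ _).1 h).2

/-- `sharp` is a `ContinuousLinearMap.inverse`, which is zero by default on a map that is not
invertible. Positivity gives injectivity, and equality of dimensions does the rest. -/
theorem metric_isInvertible (y : N) : (g.inner y).IsInvertible := by
  have hinj : Function.Injective (g.inner y).toLinearMap := by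
    refine (injective_iff_map_eq_zero _).2 fun v hv ↦ ?_
    by_contra h
    have h1 := g.pos y v h
    have h2 : g.inner y v = 0 := hv
    simp [h2] at h1
  have hdim : finrank ℝ (TangentSpace (𝓡 d) y) = finrank ℝ (TangentSpace (𝓡 d) y →L[ℝ] ℝ) := by
    rw [← (LinearMap.toContinuousLinearMap :
      (TangentSpace (𝓡 d) y →ₗ[ℝ] ℝ) ≃ₗ[ℝ] (TangentSpace (𝓡 d) y →L[ℝ] ℝ)).finrank_eq]
    exact (Subspace.dual_finrank_eq (K := ℝ)).symm
  have : FiniteDimensional ℝ (TangentSpace (𝓡 d) y →L[ℝ] ℝ) :=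
    (LinearMap.toContinuousLinearMap :
      (TangentSpace (𝓡 d) y →ₗ[ℝ] ℝ) ≃ₗ[ℝ] (TangentSpace (𝓡 d) y →L[ℝ] ℝ)).finiteDimensional
  exact ⟨(LinearMap.linearEquivOfInjective _ hinj hdim).toContinuousLinearEquiv, rfl⟩

theorem eq_sharp_iff (y : N) (α : TangentSpace (𝓡 d) y →L[ℝ] ℝ) (v : TangentSpace (𝓡 d) y) :
    v = sharp g.inner y α ↔ ∀ w, g.inner y v w = α w := by
  obtain ⟨e, he⟩ := metric_isInvertible g y
  have h : sharp g.inner y α = e.symm α := by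
    rw [sharp, ← he, ContinuousLinearMap.inverse_equiv]
    rfl
  rw [h, ContinuousLinearEquiv.eq_symm_apply, ContinuousLinearMap.ext_iff, ← he]
  rfl

theorem metric_ext {y : N} {v v' : TangentSpace (𝓡 d) y}
    (h : ∀ w, g.inner y v w = g.inner y v' w) : v = v' :=
  ((eq_sharp_iff g y (g.inner y v') v).2 h).trans ((eq_sharp_iff g y _ v').2 fun _ ↦ rfl).symm

theorem metric_sharp (y : N) (α : TangentSpace (𝓡 d) y →L[ℝ] ℝ) (w : TangentSpace (𝓡 d) y) :
    g.inner y (sharp g.inner y α) w = α w :=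
  (eq_sharp_iff g y α _).1 rfl w

/-- Replacing `Z` by `h • Z`, the terms `dh(X) G(Y, Z)` and `dh(Y) G(X, Z)` from the derivatives
cancel against those from the brackets `[X, hZ]` and `[Y, hZ]`. -/
theorem tensorial_koszul_third {X Y : Π y : N, TangentSpace (𝓡 d) y} {y : N}
    (hX : DifferentiableFieldAt X y) (hY : DifferentiableFieldAt Y y) :
    TensorialAt (𝓡 d) (EuclideanSpace ℝ (Fin d)) (fun Z ↦ koszul g.inner X Y Z y) y where
  smul {h Z} hh hZ := by
    simp only [koszul, Pi.smul_apply', map_smul, smul_eq_mul, smul_apply,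
      VectorField.mlieBracket_smul_right hh hZ, map_add, add_apply]
    rw [mvfderiv_fun_mul hh (mdifferentiableAt_metric g hY hZ),
      mvfderiv_fun_mul hh (mdifferentiableAt_metric g hX hZ)]
    simp only [add_apply, smul_apply, smul_eq_mul]
    rw [g.symm y (Z y) (X y), g.symm y (Z y) (Y y)]
    ring
  add {Z W} hZ hW := by
    simp only [koszul, Pi.add_apply, map_add, add_apply,
      VectorField.mlieBracket_add_right hZ hW]
    rw [mvfderiv_fun_add (mdifferentiableAt_metric g hY hZ) (mdifferentiableAt_metric g hY hW),
      mvfderiv_fun_add (mdifferentiableAt_metric g hX hZ) (mdifferentiableAt_metric g hX hW)]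
    simp only [add_apply]
    ring

theorem tensorial_koszul_first {Y Z : Π y : N, TangentSpace (𝓡 d) y} {y : N}
    (hY : DifferentiableFieldAt Y y) (hZ : DifferentiableFieldAt Z y) :
    TensorialAt (𝓡 d) (EuclideanSpace ℝ (Fin d)) (fun X ↦ koszul g.inner X Y Z y) y where
  smul {h X} hh hX := by
    simp only [koszul, Pi.smul_apply', map_smul, smul_eq_mul, smul_apply,
      VectorField.mlieBracket_smul_left hh hX, map_add, add_apply]
    rw [mvfderiv_fun_mul hh (mdifferentiableAt_metric g hX hZ),
      mvfderiv_fun_mul hh (mdifferentiableAt_metric g hX hY)]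
    simp only [add_apply, smul_apply, smul_eq_mul]
    ring
  add {X W} hX hW := by
    simp only [koszul, Pi.add_apply, map_add, add_apply,
      VectorField.mlieBracket_add_left hX hW]
    rw [mvfderiv_fun_add (mdifferentiableAt_metric g hX hZ) (mdifferentiableAt_metric g hW hZ),
      mvfderiv_fun_add (mdifferentiableAt_metric g hX hY) (mdifferentiableAt_metric g hW hY)]
    simp only [add_apply]
    ring

theorem koszul_add_second {X Y W Z : Π y : N, TangentSpace (𝓡 d) y} {y : N}
    (hX : DifferentiableFieldAt X y) (hY : DifferentiableFieldAt Y y) (hW : DifferentiableFieldAt W y)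
    (hZ : DifferentiableFieldAt Z y) :
    koszul g.inner X (Y + W) Z y = koszul g.inner X Y Z y + koszul g.inner X W Z y := by
  simp only [koszul, Pi.add_apply, map_add, add_apply,
    VectorField.mlieBracket_add_left hY hW, VectorField.mlieBracket_add_right hY hW]
  rw [mvfderiv_fun_add (mdifferentiableAt_metric g hY hZ) (mdifferentiableAt_metric g hW hZ),
    mvfderiv_fun_add (mdifferentiableAt_metric g hX hY) (mdifferentiableAt_metric g hX hW)]
  simp only [add_apply]
  ring

/-- Here the derivative and the bracket contributions `dh(X) G(Y, Z)` add up instead of cancelling;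
the resulting factor 2 meets the 1/2 of the Koszul formula to give the Leibniz rule. -/
theorem koszul_smul_second {h : N → ℝ} {X Y Z : Π y : N, TangentSpace (𝓡 d) y} {y : N}
    (hh : MDifferentiableAt (𝓡 d) 𝓘(ℝ) h y)
    (hX : DifferentiableFieldAt X y) (hY : DifferentiableFieldAt Y y) (hZ : DifferentiableFieldAt Z y) :
    koszul g.inner X (h • Y) Z y =
      h y * koszul g.inner X Y Z y + 2 * (mvfderiv (𝓡 d) h y (X y) * g.inner y (Y y) (Z y)) := by
  simp only [koszul, Pi.smul_apply', map_smul, smul_eq_mul, smul_apply,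
    VectorField.mlieBracket_smul_left hh hY, VectorField.mlieBracket_smul_right hh hY, map_add,
    add_apply]
  rw [mvfderiv_fun_mul hh (mdifferentiableAt_metric g hY hZ),
    mvfderiv_fun_mul hh (mdifferentiableAt_metric g hX hY)]
  simp only [add_apply, smul_apply, smul_eq_mul]
  rw [g.symm y (Y y) (X y)]
  ring

/-- The Koszul formula characterizing the Levi-Civita connection. -/
theorem metric_leviCivita {X Y Z : Π y : N, TangentSpace (𝓡 d) y} {y : N}
    (hX : DifferentiableFieldAt X y) (hY : DifferentiableFieldAt Y y) (hZ : DifferentiableFieldAt Z y) :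
    g.inner y (leviCivita g.inner Y y (X y)) (Z y) = (1 / 2 : ℝ) * koszul g.inner X Y Z y := by
  let X' := FiberBundle.extend (EuclideanSpace ℝ (Fin d)) (X y)
  have hX' : DifferentiableFieldAt X' y := FiberBundle.mdifferentiableAt_extend ..
  have hT := tensorial_koszul_third g hX' hY
  have hlin : (LinearMap.toContinuousLinearMap ((tangentBasis y).constr ℝ fun a ↦
      (1 / 2 : ℝ) * koszul g.inner X' Y
        (FiberBundle.extend (EuclideanSpace ℝ (Fin d)) (tangentBasis y a)) y)) =
      (1 / 2 : ℝ) • TensorialAt.mkHom (fun Z ↦ koszul g.inner X' Y Z y) y hT := by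
    -- On basis vectors `mkHom` evaluates the Koszul expression on the same extensions that
    -- `leviCivita` uses.
    refine ContinuousLinearMap.coe_injective ((tangentBasis y).ext fun a ↦ ?_)
    simp only [LinearMap.coe_toContinuousLinearMap, Basis.constr_basis,
      ContinuousLinearMap.toLinearMap_smul, LinearMap.smul_apply, smul_eq_mul]
    rfl
  rw [leviCivita, metric_sharp]
  refine (congrArg (fun T : TangentSpace (𝓡 d) y →L[ℝ] ℝ ↦ T (Z y)) hlin).trans ?_
  simp only [smul_apply, smul_eq_mul]
  rw [TensorialAt.mkHom_apply hT hZ]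
  congr 1
  -- Only the value of the first field at `y` matters, so the extension `X'` may be replaced by `X`.
  exact (tensorial_koszul_first g hY hZ).pointwise hX' hX (by simp [X'])

theorem metric_leviCivita_extend {Y : Π y : N, TangentSpace (𝓡 d) y} {y : N}
    (v w : TangentSpace (𝓡 d) y) (hY : DifferentiableFieldAt Y y) :
    g.inner y (leviCivita g.inner Y y v) w =
      (1 / 2 : ℝ) * koszul g.inner (FiberBundle.extend (EuclideanSpace ℝ (Fin d)) v) Y
        (FiberBundle.extend (EuclideanSpace ℝ (Fin d)) w) y := by
  have h := metric_leviCivita g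
    (FiberBundle.mdifferentiableAt_extend (𝓡 d) (EuclideanSpace ℝ (Fin d)) v) hY
    (FiberBundle.mdifferentiableAt_extend (𝓡 d) (EuclideanSpace ℝ (Fin d)) w)
  rwa [FiberBundle.extend_apply_self, FiberBundle.extend_apply_self] at h

theorem isDirectionalConnection_leviCivita :
    IsDirectionalConnection (EuclideanSpace ℝ (Fin d)) (leviCivita g.inner) where
  add {s t y} v hs ht := by
    refine metric_ext g fun w ↦ ?_
    rw [map_add, add_apply, metric_leviCivita_extend g v w hs, metric_leviCivita_extend g v w ht,
      metric_leviCivita_extend g v w (mdifferentiableAt_add_section hs ht),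
      koszul_add_second g (FiberBundle.mdifferentiableAt_extend ..) hs ht
        (FiberBundle.mdifferentiableAt_extend ..), mul_add]
  leibniz {h s y} v hh hs := by
    refine metric_ext g fun w ↦ ?_
    rw [map_add, add_apply, map_smul, map_smul, smul_apply, smul_apply,
      metric_leviCivita_extend g v w hs, metric_leviCivita_extend g v w (hh.smul_section hs),
      koszul_smul_second g hh (FiberBundle.mdifferentiableAt_extend ..) hs
        (FiberBundle.mdifferentiableAt_extend ..), FiberBundle.extend_apply_self,
      FiberBundle.extend_apply_self, smul_eq_mul, smul_eq_mul]
    ring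

variable {g} {f : Diffeomorph (𝓡 d) (𝓡 d) N N ∞}

theorem koszul_push (hf : ∀ (y : N) (v w : TangentSpace (𝓡 d) y),
      g.inner (f y) (mfderiv (𝓡 d) (𝓡 d) f y v) (mfderiv (𝓡 d) (𝓡 d) f y w) = g.inner y v w)
    {X Y Z : Π y : N, TangentSpace (𝓡 d) y} {y : N}
    (hX : DifferentiableFieldAt X y) (hY : DifferentiableFieldAt Y y) (hZ : DifferentiableFieldAt Z y) :
    koszul g.inner ((tangentAut f).push X) ((tangentAut f).push Y) ((tangentAut f).push Z) (f y) =
      koszul g.inner X Y Z y := by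
  have hp (X : Π y : N, TangentSpace (𝓡 d) y) (y : N) :
      (tangentAut f).push X (f y) = mfderiv (𝓡 d) (𝓡 d) f y (X y) := (tangentAut f).push_base X y
  have hd {X Y Z : Π y : N, TangentSpace (𝓡 d) y} (hX : DifferentiableFieldAt X y)
      (hY : DifferentiableFieldAt Y y) :
      mvfderiv (𝓡 d) (fun y ↦ g.inner y ((tangentAut f).push X y) ((tangentAut f).push Y y)) (f y)
        (mfderiv (𝓡 d) (𝓡 d) f y (Z y)) =
      mvfderiv (𝓡 d) (fun y ↦ g.inner y (X y) (Y y)) y (Z y) := by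
    refine (mvfderiv_comp_apply y (mdifferentiableAt_metric g
      ((tangentAut f).mdifferentiableAt_push hX) ((tangentAut f).mdifferentiableAt_push hY))
      (f.mdifferentiable (by simp) y) (Z y)).symm.trans ?_
    have hfun : (fun y ↦ g.inner y ((tangentAut f).push X y) ((tangentAut f).push Y y)) ∘ f =
        fun y ↦ g.inner y (X y) (Y y) := funext fun y' ↦ by
      simp only [Function.comp_apply, hp, hf]
    exact congrArg (fun k ↦ mvfderiv (𝓡 d) k y (Z y)) hfun
  simp only [koszul, hp, mlieBracket_push f hX hY, mlieBracket_push f hX hZ,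
    mlieBracket_push f hY hZ, hf, hd hX hY, hd hX hZ, hd hY hZ]

/-- Both sides are tested against vectors `df(w)`. The pushed extensions of `v` and `w` need not be
the extensions chosen at `f y`, which is why the Koszul formula is needed for arbitrary
differentiable fields. -/
theorem leviCivita_push (hf : ∀ (y : N) (v w : TangentSpace (𝓡 d) y),
      g.inner (f y) (mfderiv (𝓡 d) (𝓡 d) f y v) (mfderiv (𝓡 d) (𝓡 d) f y w) = g.inner y v w)
    {Y : Π y : N, TangentSpace (𝓡 d) y} {y : N} (v : TangentSpace (𝓡 d) y)
    (hY : DifferentiableFieldAt Y y) :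
    leviCivita g.inner ((tangentAut f).push Y) (f y) (mfderiv (𝓡 d) (𝓡 d) f y v) =
      mfderiv (𝓡 d) (𝓡 d) f y (leviCivita g.inner Y y v) := by
  refine metric_ext g fun w ↦ ?_
  obtain ⟨w, rfl⟩ := ((tangentAut f).fiber y).surjective w
  have hp (u : TangentSpace (𝓡 d) y) :
      (tangentAut f).push (FiberBundle.extend (EuclideanSpace ℝ (Fin d)) u) (f y) =
        mfderiv (𝓡 d) (𝓡 d) f y u :=
    ((tangentAut f).push_base _ y).trans
      (congrArg ((tangentAut f).fiber y) (FiberBundle.extend_apply_self ..))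
  have hX := FiberBundle.mdifferentiableAt_extend (𝓡 d) (EuclideanSpace ℝ (Fin d)) v
  have hZ := FiberBundle.mdifferentiableAt_extend (𝓡 d) (EuclideanSpace ℝ (Fin d)) w
  have h := metric_leviCivita g ((tangentAut f).mdifferentiableAt_push hX)
    ((tangentAut f).mdifferentiableAt_push hY) ((tangentAut f).mdifferentiableAt_push hZ)
  refine Eq.trans ?_ (h.trans ?_)
  · exact (congrArg₂ (fun a b ↦ g.inner (f y) (leviCivita g.inner ((tangentAut f).push Y) (f y) a) b)
      (hp v) (hp w)).symm
  · exact (congrArg _ (koszul_push hf hX hY hZ)).trans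
      ((metric_leviCivita_extend g v w hY).symm.trans (hf y _ w).symm)

theorem sharp_comp_mfderiv (hf : ∀ (y : N) (v w : TangentSpace (𝓡 d) y),
      g.inner (f y) (mfderiv (𝓡 d) (𝓡 d) f y v) (mfderiv (𝓡 d) (𝓡 d) f y w) = g.inner y v w)
    (y : N) (α : TangentSpace (𝓡 d) (f y) →L[ℝ] ℝ) :
    sharp g.inner (f y) α =
      mfderiv (𝓡 d) (𝓡 d) f y (sharp g.inner y (α.comp (mfderiv (𝓡 d) (𝓡 d) f y))) := by
  refine ((eq_sharp_iff g _ _ _).2 fun w ↦ ?_).symm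
  obtain ⟨w, rfl⟩ := ((tangentAut f).fiber y).surjective w
  exact (hf _ _ _).trans (metric_sharp g _ _ _)

end LeviCivita

/-! ### Linear algebra of vector-valued forms, traces and tensors. -/

section FormAlgebra

variable {M : Type*} [TopologicalSpace M] [ChartedSpace (EuclideanSpace ℝ (Fin 4)) M]
  [IsManifold (𝓡 4) ∞ M] {W W' : Type*} [AddCommGroup W] [Module ℝ W] [AddCommGroup W']
  [Module ℝ W']

theorem hodgeStar_compAlternatingMap (o : ManifoldOrientation M) (g : LorentzianMetric M) (x : M)
    (L : W →ₗ[ℝ] W') (ρ : TangentSpace (𝓡 4) x [⋀^Fin 2]→ₗ[ℝ] W) :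
    hodgeStar o g x (L.compAlternatingMap ρ) = L.compAlternatingMap (hodgeStar o g x ρ) := by
  change _ = LinearMap.compAlternatingMapₗ ℝ L _
  simp only [hodgeStar, map_smul, map_sum]
  refine congrArg _ (Finset.sum_congr rfl fun i _ ↦ Finset.sum_congr rfl fun j _ ↦
    Finset.sum_congr rfl fun k _ ↦ Finset.sum_congr rfl fun l _ ↦ congrArg _ ?_)
  exact AlternatingMap.ext fun v ↦ (L.map_smul _ _).symm

theorem formInner_compAlternatingMap (g : LorentzianMetric M) (x : M) {Q : W →ₗ[ℝ] W →ₗ[ℝ] ℝ}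
    {Q' : W' →ₗ[ℝ] W' →ₗ[ℝ] ℝ} {L : W →ₗ[ℝ] W'} (hL : ∀ s t, Q' (L s) (L t) = Q s t)
    (α β : TangentSpace (𝓡 4) x [⋀^Fin 2]→ₗ[ℝ] W) :
    formInner g x Q' (L.compAlternatingMap α) (L.compAlternatingMap β) = formInner g x Q α β := by
  simp only [formInner, LinearMap.compAlternatingMap_apply, hL]

theorem metricTrace_map {d : ℕ} {N : Type*} [TopologicalSpace N]
    [ChartedSpace (EuclideanSpace ℝ (Fin d)) N] (G : MetricField d N) (x : N) (L : W →ₗ[ℝ] W')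
    (B : TangentSpace (𝓡 d) x → TangentSpace (𝓡 d) x → W) :
    metricTrace G x (fun u v ↦ L (B u v)) = L (metricTrace G x B) := by
  simp only [metricTrace, map_sum, map_smul]

/-- The freedom in the basis is what is used later: a basis at `y` is matched with its image under
`df₀` at `f₀ y`. -/
theorem dualTensorHomEquiv_symm_eq_sum {ι V : Type*} [Fintype ι] [AddCommGroup V] [Module ℝ V]
    [FiniteDimensional ℝ V] (b : Basis ι ℝ V) (A : V →ₗ[ℝ] W) :
    (dualTensorHomEquiv (R := ℝ) (M := V) (N := W)).symm A =
      ∑ i, b.coord i ⊗ₜ[ℝ] A (b i) := by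
  classical
  rw [LinearEquiv.symm_apply_eq]
  refine b.ext fun j ↦ ?_
  rw [map_sum, LinearMap.sum_apply]
  simp [dualTensorHomEquiv, Finsupp.single_apply]

end FormAlgebra

/-! ### Behaviour of the tension field under isometries of the target. -/

section Tension

variable {M : Type*} [TopologicalSpace M] [ChartedSpace (EuclideanSpace ℝ (Fin 4)) M]
  [IsManifold (𝓡 4) ∞ M]
  {d : ℕ} {𝓜 : Type*} [TopologicalSpace 𝓜] [ChartedSpace (EuclideanSpace ℝ (Fin d)) 𝓜]
  [IsManifold (𝓡 d) ∞ 𝓜] {f : Diffeomorph (𝓡 d) (𝓡 d) 𝓜 𝓜 ∞}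

/-- The first term is `pullbackCov_fiber` for the tangent bundle and the automorphism `df`; in the
second, the connection of `g` on `M` is untouched and only the chain rule is needed. -/
theorem secondFundamentalForm_isometry (g : MetricField 4 M)
    {G : ContMDiffRiemannianMetric (𝓡 d) ∞ (EuclideanSpace ℝ (Fin d))
      (fun y : 𝓜 ↦ TangentSpace (𝓡 d) y)}
    (hf : ∀ (y : 𝓜) (v w : TangentSpace (𝓡 d) y),
      G.inner (f y) (mfderiv (𝓡 d) (𝓡 d) f y v) (mfderiv (𝓡 d) (𝓡 d) f y w) = G.inner y v w)
    {φ : M → 𝓜} (hφ : ContMDiff (𝓡 4) (𝓡 d) ∞ φ) (x : M) (u v : TangentSpace (𝓡 4) x) :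
    secondFundamentalForm g G.inner (fun x ↦ f (φ x)) x u v =
      mfderiv (𝓡 d) (𝓡 d) f (φ x) (secondFundamentalForm g G.inner φ x u v) := by
  have hchain (x' : M) (w : TangentSpace (𝓡 4) x') :
      mfderiv (𝓡 4) (𝓡 d) (fun x ↦ f (φ x)) x' w =
        mfderiv (𝓡 d) (𝓡 d) f (φ x') (mfderiv (𝓡 4) (𝓡 d) φ x' w) :=
    mfderiv_comp_apply x' (f.mdifferentiable (by simp) _) (hφ.mdifferentiable (by simp) _) w
  have hV := FiberBundle.mdifferentiableAt_extend (𝓡 4) (EuclideanSpace ℝ (Fin 4)) v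
  have hσ : MDifferentiableAt (𝓡 4) ((𝓡 d).prod 𝓘(ℝ, EuclideanSpace ℝ (Fin d)))
      (fun x' ↦ TotalSpace.mk' (EuclideanSpace ℝ (Fin d)) (E := fun y : 𝓜 ↦ TangentSpace (𝓡 d) y)
        (φ x') (mfderiv (𝓡 4) (𝓡 d) φ x'
          (FiberBundle.extend (EuclideanSpace ℝ (Fin 4)) v x'))) x :=
    -- The section `dφ(V)` along `φ` is the tangent map of `φ` composed with `V`.
    ((hφ.contMDiff_tangentMap (m := ∞) le_rfl).mdifferentiable (by simp) _).comp x hV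
  have h := pullbackCov_fiber (isDirectionalConnection_leviCivita G) (tangentAut f)
    (fun s y v hs ↦ leviCivita_push hf v hs) hσ u
  unfold secondFundamentalForm
  rw [map_sub]
  refine congrArg₂ (· - ·) (Eq.trans ?_ h) (hchain x _)
  congr 1
  funext x'
  exact hchain x' _

theorem modifiedTension_isometry {Sig : ScalarStructure d 𝓜} (g : LorentzianMetric M)
    (hf : ∀ (y : 𝓜) (v w : TangentSpace (𝓡 d) y),
      Sig.metric.inner (f y) (mfderiv (𝓡 d) (𝓡 d) f y v) (mfderiv (𝓡 d) (𝓡 d) f y w) =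
        Sig.metric.inner y v w)
    (hpot : ∀ y, Sig.potential (f y) = Sig.potential y)
    {φ : M → 𝓜} (hφ : ContMDiff (𝓡 4) (𝓡 d) ∞ φ) (x : M) :
    modifiedTension Sig g (fun x ↦ f (φ x)) x =
      mfderiv (𝓡 d) (𝓡 d) f (φ x) (modifiedTension Sig g φ x) := by
  unfold modifiedTension
  rw [map_sub]
  refine congrArg₂ (· - ·) ?_ ?_
  · refine Eq.trans ?_ (metricTrace_map g.inner x (mfderiv (𝓡 d) (𝓡 d) f (φ x)).toLinearMap
      (secondFundamentalForm g.inner Sig.metric.inner φ x))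
    exact congrArg (metricTrace g.inner x)
      (funext fun u ↦ funext fun v ↦ secondFundamentalForm_isometry g.inner hf hφ x u v)
  · unfold gradient
    rw [sharp_comp_mfderiv hf]
    congr 2
    -- What remains is `dΦ ∘ df = d(Φ ∘ f) = dΦ`.
    refine (mvfderiv_comp (φ x) (Sig.smooth_potential.mdifferentiable (by simp) _)
      (f.mdifferentiable (by simp) _)).symm.trans ?_
    exact congrArg (fun k ↦ mvfderiv (𝓡 d) k (φ x)) (funext hpot)

end Tension

/-! ### Transformation of the electromagnetic equation and of the fundamental field. -/

section Duality

variable {d : ℕ} {𝓜 : Type*} [TopologicalSpace 𝓜] [ChartedSpace (EuclideanSpace ℝ (Fin d)) 𝓜]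
  [IsManifold (𝓡 d) ∞ 𝓜]
  {F : Type*} [NormedAddCommGroup F] [NormedSpace ℝ F] [FiniteDimensional ℝ F]
  {S : 𝓜 → Type*} [TopologicalSpace (TotalSpace F S)]
  [∀ y, AddCommGroup (S y)] [∀ y, Module ℝ (S y)] [∀ y, TopologicalSpace (S y)]
  [∀ y, IsTopologicalAddGroup (S y)] [∀ y, ContinuousSMul ℝ (S y)]
  [FiberBundle F S] [VectorBundle ℝ F S] [ContMDiffVectorBundle ∞ F S (𝓡 d)]
  {M : Type*} [TopologicalSpace M] [ChartedSpace (EuclideanSpace ℝ (Fin 4)) M]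
  [IsManifold (𝓡 4) ∞ M]

theorem DualityStructure.isDirectionalConnection (Δ : DualityStructure d F S) :
    IsDirectionalConnection F (fun s y (v : TangentSpace (𝓡 d) y) ↦ Δ.D s y v) where
  add v hs ht := by
    rw [Δ.D.isCovariantDerivativeOnUniv.add hs ht, add_apply]
  leibniz v hh hs := by
    rw [Δ.D.isCovariantDerivativeOnUniv.leibniz hs hh]
    rfl

/-- The vector fields live on `M` and are not moved by `f`: the bracket terms transform by
linearity, the three covariant derivatives by `pullbackCov_fiber`. Smoothness of the fields makes
each `V(A, B)` differentiable. -/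
theorem IsDualitySymmetry.twistedExteriorDerivative_fiber {Δ : DualityStructure d F S}
    {f : UnbasedAut d F S} (hf : IsDualitySymmetry Δ f) (p : FieldPair d F S M)
    {X Y Z : Π x : M, TangentSpace (𝓡 4) x} (hX : SmoothVectorField X) (hY : SmoothVectorField Y)
    (hZ : SmoothVectorField Z) (x : M) :
    twistedExteriorDerivative Δ (f.act p).φ (f.act p).V X Y Z x =
      f.fiber (p.φ x) (twistedExteriorDerivative Δ p.φ p.V X Y Z x) := by
  have : ContMDiffVectorBundle 1 F S (𝓡 d) := inferInstance
  have key {A B : Π x : M, TangentSpace (𝓡 4) x} (hA : SmoothVectorField A)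
      (hB : SmoothVectorField B) (v : TangentSpace (𝓡 4) x) :
      pullbackCov F (fun s y (v : TangentSpace (𝓡 d) y) ↦ Δ.D s y v) (f.act p).φ
          (fun x' ↦ (f.act p).V x' ![A x', B x']) x v =
        f.fiber (p.φ x) (pullbackCov F (fun s y (v : TangentSpace (𝓡 d) y) ↦ Δ.D s y v) p.φ
          (fun x' ↦ p.V x' ![A x', B x']) x v) :=
    pullbackCov_fiber Δ.isDirectionalConnection f
      (fun s y v hs ↦ hf.parallel s (f.push s) (f.push_base s) y v hs)
      ((p.smooth_V A B hA hB).mdifferentiable (by simp) x) v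
  unfold twistedExteriorDerivative
  simp only [map_sub, map_add, key hY hZ, key hX hZ, key hX hY]
  rfl

theorem UnbasedAut.push_Ad (f : UnbasedAut d F S) (A : Π y : 𝓜, S y →L[ℝ] S y)
    (s : Π y : 𝓜, S y) :
    (fun y ↦ f.Ad A y (f.push s y)) = f.push fun y ↦ A y (s y) := by
  funext y
  obtain ⟨y, rfl⟩ := (show Function.Surjective f.base from f.base.surjective) y
  rw [f.push_base, f.push_base, f.Ad_base]

variable {Ξ : ElectromagneticStructure d F S} {f : UnbasedAut d F S}

/-- Pushing forward commutes with `D` because `f` is parallel, and turns `J` into `Ad(f)(J)`; hence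
it carries `D ∘ J - J ∘ D` to its twisted counterpart. Tensoriality allows the value at `f s` to be
computed from the pushed extension of `s`. -/
theorem IsDualitySymmetry.fundamentalForm_twist (hf : IsDualitySymmetry Ξ.toDualityStructure f)
    (y : 𝓜) (v : TangentSpace (𝓡 d) y) (s : S y) :
    (Ξ.twist f hf.symplectic).fundamentalForm (f.base y) (mfderiv (𝓡 d) (𝓡 d) f.base y v)
      (f.fiber y s) = f.fiber y (Ξ.fundamentalForm y v s) := by
  have : ContMDiffVectorBundle 1 F S (𝓡 d) := inferInstance
  let σ : Π y : 𝓜, S y := FiberBundle.extend F s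
  have hσ := FiberBundle.mdifferentiableAt_extend (𝓡 d) F s
  have hpush : f.push σ (f.base y) = f.fiber y s := by
    rw [f.push_base]
    exact congrArg (f.fiber y) (FiberBundle.extend_apply_self ..)
  have h := TensorialAt.mkHom_apply ((Ξ.twist f hf.symplectic).tensorial_covJ (f.base y))
    (f.mdifferentiableAt_push hσ)
  have hcov : (Ξ.twist f hf.symplectic).covJ (f.base y) (f.push σ)
      (mfderiv (𝓡 d) (𝓡 d) f.base y v) = f.fiber y (Ξ.covJ y σ v) := by
    have h1 := hf.parallel σ (f.push σ) (f.push_base σ) y v hσ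
    have h2 := hf.parallel (fun y ↦ Ξ.J y (σ y)) (f.push fun y ↦ Ξ.J y (σ y)) (f.push_base _) y v
      (Ξ.mdifferentiableAt_J hσ)
    have h3 : (fun y ↦ (Ξ.twist f hf.symplectic).J y (f.push σ y)) =
      f.push fun y ↦ Ξ.J y (σ y) := f.push_Ad Ξ.J σ
    have h4 := f.Ad_base Ξ.J y (Ξ.D σ y v)
    unfold ElectromagneticStructure.covJ
    rw [h3, sub_apply, sub_apply, map_sub]
    refine congrArg₂ (· - ·) h2 ?_
    refine Eq.trans ?_ h4
    exact congrArg _ h1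
  rw [← hpush]
  exact (congrArg (fun T ↦ T (mfderiv (𝓡 d) (𝓡 d) f.base y v)) h).trans hcov

theorem extendedFormInner_fundamentalField (g : LorentzianMetric M) (Sig : ScalarStructure d 𝓜)
    (Ξ : ElectromagneticStructure d F S) (x : M) {y : 𝓜} (Q : S y →ₗ[ℝ] S y →ₗ[ℝ] ℝ)
    (α β : TangentSpace (𝓡 4) x [⋀^Fin 2]→ₗ[ℝ] S y) {ι : Type*} [Fintype ι]
    (b : Basis ι ℝ (TangentSpace (𝓡 d) y)) :
    extendedFormInner g x Q α (fundamentalField Sig Ξ y) β =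
      ∑ i, formInner g x Q α ((Ξ.fundamentalForm y (b i)).compAlternatingMap β) •
        sharp Sig.metric.inner y (b.coord i).toContinuousLinearMap := by
  unfold extendedFormInner fundamentalField
  rw [dualTensorHomEquiv_symm_eq_sum b, map_sum, map_sum]
  rfl

theorem IsScalarElectromagneticDuality.extendedFormInner_twist {Sig : ScalarStructure d 𝓜}
    (hf : IsScalarElectromagneticDuality Sig Ξ.toDualityStructure f) (g : LorentzianMetric M)
    (x : M) {y : 𝓜} (α β : TangentSpace (𝓡 4) x [⋀^Fin 2]→ₗ[ℝ] S y) :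
    extendedFormInner g x ((Ξ.twist f hf.symplectic).Q (f.base y))
        ((f.fiber y).toLinearMap.compAlternatingMap α)
        (fundamentalField Sig (Ξ.twist f hf.symplectic) (f.base y))
        ((f.fiber y).toLinearMap.compAlternatingMap β) =
      mfderiv (𝓡 d) (𝓡 d) f.base y
        (extendedFormInner g x (Ξ.Q y) α (fundamentalField Sig Ξ y) β) := by
  let T : TangentSpace (𝓡 d) y ≃ₗ[ℝ] TangentSpace (𝓡 d) (f.base y) :=
    ((tangentAut f.base).fiber y).toLinearEquiv
  -- With `J` replaced by `Ad(f)(J)`, the fibres of `f` become isometries for the two scalar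
  -- products `Q`.
  have hQ (s t : S y) : (Ξ.twist f hf.symplectic).Q (f.base y) (f.fiber y s) (f.fiber y t) =
      Ξ.Q y s t :=
    (congrArg (fun r ↦ Ξ.pairing (f.base y) r (f.fiber y t)) (f.Ad_base Ξ.J y s)).trans
      (hf.symplectic y _ t)
  -- The basis at `f₀ y` is the image under `df₀` of the one at `y`, so its dual basis pulls back to
  -- the dual basis at `y` and the sums match index by index.
  rw [extendedFormInner_fundamentalField g Sig Ξ x _ α β (tangentBasis y),
    extendedFormInner_fundamentalField g Sig _ x _ _ _ ((tangentBasis y).map T), map_sum]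
  refine Finset.sum_congr rfl fun i _ ↦ ?_
  rw [map_smul]
  refine congrArg₂ (· • ·) ?_ ?_
  · rw [← formInner_compAlternatingMap g x (L := (f.fiber y).toLinearMap) hQ]
    congr 1
    ext v
    exact hf.fundamentalForm_twist y (tangentBasis y i) (β v)
  · rw [sharp_comp_mfderiv hf.isometry]
    congr 2
    ext v
    change ((tangentBasis y).map T).coord i (T v) = (tangentBasis y).coord i v
    simp

end Duality

/-! ### Bijectivity of the action on all pairs, and equivalence of the equations. -/

section Action

variable {d : ℕ} {𝓜 : Type*} [TopologicalSpace 𝓜] [ChartedSpace (EuclideanSpace ℝ (Fin d)) 𝓜]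
  [IsManifold (𝓡 d) ∞ 𝓜]
  {F : Type*} [NormedAddCommGroup F] [NormedSpace ℝ F] [FiniteDimensional ℝ F]
  {S : 𝓜 → Type*} [TopologicalSpace (TotalSpace F S)]
  [∀ y, AddCommGroup (S y)] [∀ y, Module ℝ (S y)] [∀ y, TopologicalSpace (S y)]
  [∀ y, IsTopologicalAddGroup (S y)] [∀ y, ContinuousSMul ℝ (S y)]
  [FiberBundle F S] [VectorBundle ℝ F S] [ContMDiffVectorBundle ∞ F S (𝓡 d)]
  {M : Type*} [TopologicalSpace M] [ChartedSpace (EuclideanSpace ℝ (Fin 4)) M]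
  [IsManifold (𝓡 4) ∞ M]

/-- The two-forms take values in different fibres until the maps are identified; comparing them in
the total space avoids transport. -/
theorem FieldPair.ext_totalSpace {p q : FieldPair d F S M} (hφ : ∀ x, p.φ x = q.φ x)
    (hV : ∀ x v, TotalSpace.mk' F (p.φ x) (p.V x v) = TotalSpace.mk' F (q.φ x) (q.V x v)) :
    p = q := by
  obtain ⟨φ, V, hVs⟩ := p
  obtain ⟨ψ, W, hWs⟩ := q
  obtain rfl : φ = ψ := ContMDiffMap.ext hφ
  obtain rfl : V = W := funext fun x ↦ AlternatingMap.ext fun v ↦ TotalSpace.mk_inj.1 (hV x v)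
  rfl

theorem UnbasedAut.mk_act (f : UnbasedAut d F S) (p : FieldPair d F S M) (x : M)
    (v : Fin 2 → TangentSpace (𝓡 4) x) :
    TotalSpace.mk' F ((f.act p).φ x) ((f.act p).V x v) =
      f.total (TotalSpace.mk' F (p.φ x) (p.V x v)) :=
  (f.total_apply _ _).symm

theorem UnbasedAut.act_injective (f : UnbasedAut d F S) : Function.Injective (f.act (M := M)) := by
  intro p q h
  refine FieldPair.ext_totalSpace (fun x ↦ f.base.injective ?_) fun x v ↦ f.total.injective ?_
  · exact congrArg (fun r : FieldPair d F S M ↦ r.φ x) h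
  · have h' := congrArg (fun r : FieldPair d F S M ↦ TotalSpace.mk' F (r.φ x) (r.V x v)) h
    exact (f.mk_act p x v).symm.trans (h'.trans (f.mk_act q x v))

/-- The isomorphism `S y ≃ S z` induced by `f`, when `f` maps `y` to `z`. -/
def UnbasedAut.fiberOfEq (f : UnbasedAut d F S) {y z : 𝓜} (h : f.base y = z) : S y ≃ₗ[ℝ] S z :=
  h ▸ (f.fiber y).toLinearEquiv

theorem UnbasedAut.total_mk_fiberOfEq_symm (f : UnbasedAut d F S) {y z : 𝓜} (h : f.base y = z)
    (s : S z) :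
    f.total (TotalSpace.mk' F y ((f.fiberOfEq h).symm s)) = TotalSpace.mk' F z s := by
  subst h
  refine (f.total_apply _ _).trans (congrArg (TotalSpace.mk' F (f.base y)) ?_)
  exact (f.fiber y).apply_symm_apply s

theorem UnbasedAut.act_surjective (f : UnbasedAut d F S) :
    Function.Surjective (f.act (M := M)) := by
  intro q
  let h (x : M) : f.base (f.base.symm (q.φ x)) = q.φ x := f.base.apply_symm_apply _
  -- The preimage is the action of `f⁻¹`. The fibre over `f₀⁻¹ (q.φ x)` is mapped to the one over
  -- `f₀ (f₀⁻¹ (q.φ x))`, hence the use of `fiberOfEq`.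
  let p : FieldPair d F S M :=
    { φ := ⟨fun x ↦ f.base.symm (q.φ x), f.base.symm.contMDiff.comp q.φ.contMDiff⟩
      V := fun x ↦ (f.fiberOfEq (h x)).symm.toLinearMap.compAlternatingMap (q.V x)
      smooth_V := fun X Y hX hY ↦ by
        refine (f.total.symm.contMDiff.comp (q.smooth_V X Y hX hY)).congr fun x ↦ ?_
        refine f.total.injective ?_
        exact (f.total_mk_fiberOfEq_symm (h x) _).trans (f.total.apply_symm_apply _).symm }
  exact ⟨p, FieldPair.ext_totalSpace h fun x v ↦
    (f.mk_act p x v).trans (f.total_mk_fiberOfEq_symm (h x) _)⟩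

variable {Sig : ScalarStructure d 𝓜} {Ξ : ElectromagneticStructure d F S} {f : UnbasedAut d F S}

theorem compAlternatingMap_fiber_inj (f : UnbasedAut d F S) (y : 𝓜) {V : Type*}
    [AddCommGroup V] [Module ℝ V] {ι : Type*} {α β : V [⋀^ι]→ₗ[ℝ] S y} :
    (f.fiber y).toLinearMap.compAlternatingMap α = (f.fiber y).toLinearMap.compAlternatingMap β ↔
      α = β :=
  ⟨fun h ↦ AlternatingMap.ext fun v ↦ (f.fiber y).injective (DFunLike.congr_fun h v),
    fun h ↦ h ▸ rfl⟩

/-- The Hodge operator commutes with linear maps of the coefficients, and `Ad(f)(J) ∘ f = f ∘ J` on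
fibres. -/
theorem twistedHodge_twist (o : ManifoldOrientation M) (g : LorentzianMetric M)
    (hf : ∀ (y : 𝓜) (s t : S y),
      Ξ.pairing (f.base y) (f.fiber y s) (f.fiber y t) = Ξ.pairing y s t)
    (p : FieldPair d F S M) (x : M) :
    twistedHodge o g (Ξ.twist f hf) (f.act p).φ x ((f.act p).V x) =
      (f.fiber (p.φ x)).toLinearMap.compAlternatingMap (twistedHodge o g Ξ p.φ x (p.V x)) := by
  unfold twistedHodge
  rw [← hodgeStar_compAlternatingMap]
  refine congrArg (hodgeStar o g x) (AlternatingMap.ext fun v ↦ ?_)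
  exact f.Ad_base Ξ.J (p.φ x) (p.V x v)

theorem act_mem_Conf_iff (o : ManifoldOrientation M) (g : LorentzianMetric M)
    (hf : ∀ (y : 𝓜) (s t : S y),
      Ξ.pairing (f.base y) (f.fiber y s) (f.fiber y t) = Ξ.pairing y s t)
    (p : FieldPair d F S M) : f.act p ∈ Conf o g (Ξ.twist f hf) ↔ p ∈ Conf o g Ξ := by
  refine forall_congr' fun x ↦ ?_
  rw [twistedHodge_twist]
  exact compAlternatingMap_fiber_inj f (p.φ x)

theorem IsDualitySymmetry.electromagneticEquation_act_iff {Δ : DualityStructure d F S}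
    (hf : IsDualitySymmetry Δ f) (p : FieldPair d F S M) :
    ElectromagneticEquation Δ (f.act p) ↔ ElectromagneticEquation Δ p := by
  refine forall_congr' fun X ↦ forall_congr' fun Y ↦ forall_congr' fun Z ↦ forall_congr' fun hX ↦
    forall_congr' fun hY ↦ forall_congr' fun hZ ↦ forall_congr' fun x ↦ ?_
  rw [hf.twistedExteriorDerivative_fiber p hX hY hZ x]
  exact (f.fiber (p.φ x)).map_eq_zero_iff

theorem IsScalarElectromagneticDuality.scalarEquation_act_iff
    (hf : IsScalarElectromagneticDuality Sig Ξ.toDualityStructure f) (o : ManifoldOrientation M)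
    (g : LorentzianMetric M) (p : FieldPair d F S M) :
    ScalarEquation o g Sig (Ξ.twist f hf.symplectic) (f.act p) ↔ ScalarEquation o g Sig Ξ p := by
  refine forall_congr' fun x ↦ ?_
  -- The differential `df₀` is written as a fibre of `tangentAut`, hence as an isomorphism, so that
  -- vanishing can be reflected as well as preserved.
  have h1 : modifiedTension Sig g (f.act p).φ x =
      (tangentAut f.base).fiber (p.φ x) (modifiedTension Sig g p.φ x) :=
    modifiedTension_isometry g hf.isometry hf.potential p.φ.contMDiff x
  have h2 : extendedFormInner g x ((Ξ.twist f hf.symplectic).Q ((f.act p).φ x))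
      (hodgeStar o g x ((f.act p).V x))
      (fundamentalField Sig (Ξ.twist f hf.symplectic) ((f.act p).φ x)) ((f.act p).V x) =
      (tangentAut f.base).fiber (p.φ x) (extendedFormInner g x (Ξ.Q (p.φ x))
        (hodgeStar o g x (p.V x)) (fundamentalField Sig Ξ (p.φ x)) (p.V x)) := by
    refine Eq.trans ?_ (hf.extendedFormInner_twist g x (hodgeStar o g x (p.V x)) (p.V x))
    rw [← hodgeStar_compAlternatingMap]
    rfl
  rw [h1, h2]
  refine Iff.trans (Eq.congr_left ?_) ((tangentAut f.base).fiber (p.φ x)).map_eq_zero_iff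
  rw [map_sub, map_smul]
  rfl

theorem IsScalarElectromagneticDuality.act_mem_Sol_iff
    (hf : IsScalarElectromagneticDuality Sig Ξ.toDualityStructure f) (o : ManifoldOrientation M)
    (g : LorentzianMetric M) (p : FieldPair d F S M) :
    f.act p ∈ Sol o g Sig (Ξ.twist f hf.symplectic) ↔ p ∈ Sol o g Sig Ξ :=
  and_congr (act_mem_Conf_iff o g hf.symplectic p) (and_congr (hf.scalarEquation_act_iff o g p)
    (hf.toIsDualitySymmetry.electromagneticEquation_act_iff p))

end Action

end ESM

end

theorem mainTheorem1
    {M : Type*} [TopologicalSpace M] [T2Space M] [SecondCountableTopology M] [ConnectedSpace M]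
    [ChartedSpace (EuclideanSpace ℝ (Fin 4)) M] [IsManifold (𝓡 4) ∞ M]
    (o : ESM.ManifoldOrientation M) (g : ESM.LorentzianMetric M)
    {d : ℕ} {𝓜 : Type*} [TopologicalSpace 𝓜] [T2Space 𝓜] [SecondCountableTopology 𝓜]
    [ConnectedSpace 𝓜] [ChartedSpace (EuclideanSpace ℝ (Fin d)) 𝓜] [IsManifold (𝓡 d) ∞ 𝓜]
    {F : Type*} [NormedAddCommGroup F] [NormedSpace ℝ F] [FiniteDimensional ℝ F]
    {S : 𝓜 → Type*} [TopologicalSpace (TotalSpace F S)]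
    [∀ y, AddCommGroup (S y)] [∀ y, Module ℝ (S y)] [∀ y, TopologicalSpace (S y)]
    [∀ y, IsTopologicalAddGroup (S y)] [∀ y, ContinuousSMul ℝ (S y)]
    [FiberBundle F S] [VectorBundle ℝ F S] [ContMDiffVectorBundle ∞ F S (𝓡 d)]
    (Sig : ESM.ScalarStructure d 𝓜) (Ξ : ESM.ElectromagneticStructure d F S)
    (f : ESM.UnbasedAut d F S)
    (hf : ESM.IsScalarElectromagneticDuality Sig Ξ.toDualityStructure f) :
    Set.BijOn (f.act (M := M)) (ESM.Sol o g Sig Ξ) (ESM.Sol o g Sig (Ξ.twist f hf.symplectic)) := by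
  refine ⟨fun p hp ↦ (hf.act_mem_Sol_iff o g p).2 hp, f.act_injective.injOn, fun q hq ↦ ?_⟩
  -- A preimage exists among all pairs; the equivalence then shows that it is a solution.
  obtain ⟨p, rfl⟩ := f.act_surjective q
  exact ⟨p, (hf.act_mem_Sol_iff o g p).1 hq, rfl⟩
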